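/- Let $\Gamma$ be a group generated by a finite set $S$, with unit $e$, and let $|g|$ be the word length of $g\in\Gamma$ with respect to $S$. Along a sequence of integers $N\to\infty$, let $\rho_N:\Gamma\to S_N$ be homomorphisms to the permutation groups of $[N]=\{1,\dots,N\}$; write $g.x=\rho_N(g)(x)$ and identify $\rho_N(g)$ with the permutation matrix $\rho_N(g)(x,y)=\mathbf 1(x=g.y)$. Assume that $\rho_N$ converges in distribution to the left regular representation $\lambda$ of $\Gamma$ on $\ell^2(\Gamma)$, that is, $\frac1N\mathrm{Tr}\,\rho_N(g)\to0$ for every $g\neq e$. Let $p=\sum_g p_g g\in\mathbb C[\Gamma]$ satisfy $p=p^*$, i.e. $p_{g^{-1}}=\overline{p_g}$ for all $g$. Put $\lambda(p)=\sum_g p_g\lambda(g)$, $R^z=(\lambda(p)-z)^{-1}$ and $P_N=\rho_N(p)=\sum_g p_g\rho_N(g)\in M_N(\mathbb C)$. Let $I_0\subset\mathbb R$ be a compact interval such that, for some $C_0\ge1$, $$C_0^{-1}\le \operatorname{Im}\langle\delta_e,R^{E+i\eta}\delta_e\rangle\le C_0\qquad\text{for all }E\in I_0,\ 0<\eta\le1,$$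 and let $I$ be a closed interval of positive length contained in the interior of $I_0$. For each $N$ let $(\varphi_\alpha)_{\alpha\in[N]}$ be any orthonormal basis of $\mathbb C^N$ consisting of eigenvectors of $P_N$, with eigenvalues $(\lambda_\alpha)$. For $J\subset\mathbb R$ let $\Lambda_J=\{\alpha:\lambda_\alpha\in J\}$, and let $J_E^\eta=[E-\eta,E+\eta]$. Inner products are conjugate-linear in the first variable, and a normalised sum over an empty index set is $0$. Let $T\subset\Gamma$ be finite and let $K_N\in M_N(\mathbb C)$ be $T$-local, i.e. $K_N(x,y)=0$ unless $x=t.y$ for some $t\in T$, with $\max_{x,y}|K_N(x,y)|\le1$. Assume that $(K_N)$ is asymptotically uncorrelated: for every $t\in T$, the functions $a_N(x)=K_N(t.x,x)$, with mean $\langle a_N\rangle=\frac1N\sum_x a_N(x)$, satisfy $$\lim_{|g|\to\infty}\ \limsup_{N\to\infty}\Bigl|\frac1N\sum_{x\in[N]}\overline{(a_N(x)-\langle a_N\rangle)}\,(a_N(g.x)-\langle a_N\rangle)\Bigr|=0 .$$ Put $\langle K_N\rangle=\sum_{t\in T}\Bigl(\frac1N\sum_{x\in[N]}K_N(t.x,x)\Bigr)\rho_N(t)$.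 Then quantum ergodicity holds in $I$: $$\lim_{N\to\infty}\frac1{|\Lambda_I|}\sum_{\alpha\in\Lambda_I}\bigl|\langle\varphi_\alpha,K_N\varphi_\alpha\rangle-\langle\varphi_\alpha,\langle K_N\rangle\varphi_\alpha\rangle\bigr|^2=0,$$ and small-scale quantum mixing holds in $I$: for all $E_1,E_2$ in the interior of $I$, $$\lim_{\eta\to0^+}\ \limsup_{N\to\infty}\frac1{|\Lambda_{J_{E_1}^\eta}|}\sum_{\alpha\in\Lambda_{J_{E_1}^\eta}}\ \sum_{\beta\in\Lambda_{J_{E_2}^\eta}}\bigl|\langle\varphi_\beta,K_N\varphi_\alpha\rangle-\langle\varphi_\beta,\langle K_N\rangle\varphi_\alpha\rangle\bigr|^2=0 .$$ -/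

import Mathlib

open Filter Topology
open scoped ENNReal ComplexConjugate

noncomputable section

namespace SchreierMixing

/-! ### The group side: word length, regular representation, resolvent -/

section Group

variable {Γ : Type*} [Group Γ]

/-- The word length of `g` with respect to `S`: the least length of a word in the letters
`s` and `s⁻¹`, `s ∈ S`, whose product is `g`. -/
def wordLength (S : Finset Γ) (g : Γ) : ℕ :=
  sInf {n : ℕ | ∃ l : List Γ, (∀ s ∈ l, s ∈ S ∨ s⁻¹ ∈ S) ∧ l.prod = g ∧ l.length = n}

/-- The condition `p = p^*` in the group algebra, where `p^* = ∑ g, conj (p g) g⁻¹`. -/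
def IsSelfAdjointElement (p : MonoidAlgebra ℂ Γ) : Prop :=
  ∀ g : Γ, p.coeff g⁻¹ = conj (p.coeff g)

/-- The Hilbert space of square-summable complex functions on `Γ`. -/
abbrev L2 (Γ : Type*) : Type _ := lp (fun _ : Γ => ℂ) 2

theorem memLp_translate (g : Γ) (f : L2 Γ) :
    Memℓp (fun v : Γ => (f : Γ → ℂ) (g⁻¹ * v)) 2 := by
  have h := lp.memℓp f
  rw [memℓp_gen_iff (by norm_num)] at h ⊢
  exact (Equiv.mulLeft g⁻¹).summable_iff.mpr h

/-- The left regular representation: `(leftRegular g f) v = f (g⁻¹ v)`, that is,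
`δ_v` is sent to `δ_{gv}`. -/
def leftRegular (g : Γ) : L2 Γ →L[ℂ] L2 Γ :=
  LinearIsometry.toContinuousLinearMap
    { toFun := fun f => ⟨fun v => (f : Γ → ℂ) (g⁻¹ * v), memLp_translate g f⟩
      map_add' := fun _ _ => rfl
      map_smul' := fun _ _ => rfl
      norm_map' := fun f => by
        change ‖(⟨fun v => (f : Γ → ℂ) (g⁻¹ * v), memLp_translate g f⟩ : L2 Γ)‖ = ‖f‖
        rw [lp.norm_eq_tsum_rpow (by norm_num), lp.norm_eq_tsum_rpow (by norm_num)]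
        congr 1
        exact (Equiv.mulLeft g⁻¹).tsum_eq
          (fun v => ‖(f : Γ → ℂ) v‖ ^ (2 : ℝ≥0∞).toReal) }

/-- The operator `λ(p) = ∑ g, p_g λ(g)` on `ℓ²(Γ)`. -/
def regularOp (p : MonoidAlgebra ℂ Γ) : L2 Γ →L[ℂ] L2 Γ :=
  ∑ g ∈ p.coeff.support, p.coeff g • leftRegular g

/-- The resolvent `(P - z)⁻¹` (used only for self-adjoint `P` and non-real `z`, where `P - z`
is invertible). -/
def resolventOp (P : L2 Γ →L[ℂ] L2 Γ) (z : ℂ) : L2 Γ →L[ℂ] L2 Γ :=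
  Ring.inverse (P - z • (1 : L2 Γ →L[ℂ] L2 Γ))

open Classical in
/-- The Dirac function at the unit of `Γ`. -/
def diracOne : L2 Γ := lp.single 2 (1 : Γ) (1 : ℂ)

/-- The diagonal entry at `(e, e)` of `Im R^z = (R^z - (R^z)^*) / (2i)`, where
`R^z = (λ(p) - z)⁻¹`; it equals the imaginary part of `⟨δ_e, R^z δ_e⟩`. -/
def imResolventAtOne (p : MonoidAlgebra ℂ Γ) (z : ℂ) : ℝ :=
  (inner ℂ (diracOne : L2 Γ) (resolventOp (regularOp p) z diracOne)).im

/-- The resolvent bound on `I₀`: for some `C₀ ≥ 1`,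
`C₀⁻¹ ≤ Im R^{E+iη}(e,e) ≤ C₀` for all `E ∈ I₀` and `0 < η ≤ 1`. -/
def ResolventBound (p : MonoidAlgebra ℂ Γ) (I₀ : Set ℝ) : Prop :=
  ∃ C₀ : ℝ, 1 ≤ C₀ ∧ ∀ E ∈ I₀, ∀ η : ℝ, 0 < η → η ≤ 1 →
    C₀⁻¹ ≤ imResolventAtOne p ((E : ℂ) + (η : ℂ) * Complex.I) ∧
    imResolventAtOne p ((E : ℂ) + (η : ℂ) * Complex.I) ≤ C₀

end Group

/-! ### Permutation representations of finite degree -/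

section Finite

variable {Γ : Type*} [Group Γ] {N : ℕ}

/-- The permutation matrix `ρ(g)(x, y) = 1 (x = g.y)`. -/
def permMatrix (ρ : Γ →* Equiv.Perm (Fin N)) (g : Γ) : Matrix (Fin N) (Fin N) ℂ :=
  Matrix.of fun x y => if x = ρ g y then 1 else 0

/-- The matrix `ρ(p) = ∑ g, p_g ρ(g)`. -/
def schreierOp (ρ : Γ →* Equiv.Perm (Fin N)) (p : MonoidAlgebra ℂ Γ) :
    Matrix (Fin N) (Fin N) ℂ :=
  ∑ g ∈ p.coeff.support, p.coeff g • permMatrix ρ g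

/-- The average `⟨a⟩ = (1/N) ∑ x, a x`. -/
def average (a : Fin N → ℂ) : ℂ := (N : ℂ)⁻¹ * ∑ x, a x

/-- The empirical covariance of `a` and its translate by `g`:
`(1/N) ∑ x, conj (a x - ⟨a⟩) * (a (g.x) - ⟨a⟩)`. -/
def covariance (ρ : Γ →* Equiv.Perm (Fin N)) (a : Fin N → ℂ) (g : Γ) : ℂ :=
  (N : ℂ)⁻¹ * ∑ x, conj (a x - average a) * (a (ρ g x) - average a)

/-- `K` is `T`-local: `K x y = 0` unless `x = g.y` for some `g ∈ T`. -/
def IsLocal (ρ : Γ →* Equiv.Perm (Fin N)) (T : Finset Γ) (K : Matrix (Fin N) (Fin N) ℂ) : Prop :=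
  ∀ x y, (¬ ∃ g ∈ T, x = ρ g y) → K x y = 0

/-- The function `x ↦ K (t.x) x` on the vertices. -/
def localCoeff (ρ : Γ →* Equiv.Perm (Fin N)) (K : Matrix (Fin N) (Fin N) ℂ) (t : Γ) :
    Fin N → ℂ := fun x => K (ρ t x) x

/-- The average `⟨K⟩ = ∑ t ∈ T, k_t ρ(t)` of a `T`-local matrix, with
`k_t = (1/N) ∑ x, K (t.x) x`. -/
def averageOp (ρ : Γ →* Equiv.Perm (Fin N)) (T : Finset Γ) (K : Matrix (Fin N) (Fin N) ℂ) :
    Matrix (Fin N) (Fin N) ℂ :=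
  ∑ t ∈ T, average (localCoeff ρ K t) • permMatrix ρ t

/-- An orthonormal basis `φ` of eigenvectors of the matrix `A`, with real eigenvalues `ev`. -/
def IsEigenbasis (A : Matrix (Fin N) (Fin N) ℂ)
    (φ : OrthonormalBasis (Fin N) ℂ (EuclideanSpace ℂ (Fin N))) (ev : Fin N → ℝ) : Prop :=
  ∀ α, Matrix.toEuclideanLin A (φ α) = (ev α : ℂ) • φ α

open Classical in
/-- `Λ_J`: the indices of the eigenvalues that lie in `J`. -/
def indexSet (ev : Fin N → ℝ) (J : Set ℝ) : Finset (Fin N) :=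
  Finset.univ.filter fun α => ev α ∈ J

/-- The matrix element `⟨φ_β, K φ_α⟩` (conjugate-linear in the first argument). -/
def matrixElement (φ : OrthonormalBasis (Fin N) ℂ (EuclideanSpace ℂ (Fin N)))
    (K : Matrix (Fin N) (Fin N) ℂ) (β α : Fin N) : ℂ :=
  inner ℂ (φ β) (Matrix.toEuclideanLin K (φ α))

/-- `(1/|Λ_I|) ∑_{α ∈ Λ_I} |⟨φ_α, K φ_α⟩ - ⟨φ_α, M φ_α⟩|²` (zero if `Λ_I` is empty). -/
def diagonalMoment (φ : OrthonormalBasis (Fin N) ℂ (EuclideanSpace ℂ (Fin N))) (ev : Fin N → ℝ)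
    (K M : Matrix (Fin N) (Fin N) ℂ) (I : Set ℝ) : ℝ :=
  ((indexSet ev I).card : ℝ)⁻¹ *
    ∑ α ∈ indexSet ev I, ‖matrixElement φ K α α - matrixElement φ M α α‖ ^ 2

/-- `(1/|Λ_I|) ∑_{α ∈ Λ_I} ∑_{β ∈ Λ_J} |⟨φ_β, K φ_α⟩ - ⟨φ_β, M φ_α⟩|²`
(zero if `Λ_I` is empty). -/
def mixedMoment (φ : OrthonormalBasis (Fin N) ℂ (EuclideanSpace ℂ (Fin N))) (ev : Fin N → ℝ)
    (K M : Matrix (Fin N) (Fin N) ℂ) (I J : Set ℝ) : ℝ :=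
  ((indexSet ev I).card : ℝ)⁻¹ *
    ∑ α ∈ indexSet ev I, ∑ β ∈ indexSet ev J,
      ‖matrixElement φ K β α - matrixElement φ M β α‖ ^ 2

end Finite

/-! ### Sequences of permutation representations -/

section Sequences

variable {Γ : Type*} [Group Γ] {N : ℕ → ℕ}

/-- Convergence in distribution to the regular representation: the normalized trace of `ρ_n(g)`
tends to `0` for every `g ≠ e`. -/
def ConvergesInDistribution (ρ : (n : ℕ) → Γ →* Equiv.Perm (Fin (N n))) : Prop :=
  ∀ g : Γ, g ≠ 1 →
    Tendsto (fun n => ((N n : ℕ) : ℂ)⁻¹ * (permMatrix (ρ n) g).trace) atTop (𝓝 0)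

/-- `σ(g) = limsup_n |covariance of a_n and its translate by g|`, as an extended real. -/
def limsupCovariance (ρ : (n : ℕ) → Γ →* Equiv.Perm (Fin (N n)))
    (a : (n : ℕ) → Fin (N n) → ℂ) (g : Γ) : ℝ≥0∞ :=
  limsup (fun n => ‖covariance (ρ n) (a n) g‖ₑ) atTop

/-- Asymptotically uncorrelated sequences of functions: `σ(g) → 0` as `|g| → ∞`, where `|·|` is
the word length with respect to `S`. -/
def IsAsympUncorrelated (S : Finset Γ) (ρ : (n : ℕ) → Γ →* Equiv.Perm (Fin (N n)))
    (a : (n : ℕ) → Fin (N n) → ℂ) : Prop :=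
  Tendsto (limsupCovariance ρ a) (comap (wordLength S) atTop) (𝓝 0)

/-- Asymptotically uncorrelated sequences of `T`-local matrices: `x ↦ K_n (t.x) x` is
asymptotically uncorrelated for each `t ∈ T`. -/
def IsAsympUncorrelatedLocal (S T : Finset Γ) (ρ : (n : ℕ) → Γ →* Equiv.Perm (Fin (N n)))
    (K : (n : ℕ) → Matrix (Fin (N n)) (Fin (N n)) ℂ) : Prop :=
  ∀ t ∈ T, IsAsympUncorrelated S ρ (fun n => localCoeff (ρ n) (K n) t)

/-- Quantum ergodicity in `I`. -/
def QuantumErgodicity (T : Finset Γ) (ρ : (n : ℕ) → Γ →* Equiv.Perm (Fin (N n)))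
    (φ : (n : ℕ) → OrthonormalBasis (Fin (N n)) ℂ (EuclideanSpace ℂ (Fin (N n))))
    (ev : (n : ℕ) → Fin (N n) → ℝ)
    (K : (n : ℕ) → Matrix (Fin (N n)) (Fin (N n)) ℂ) (I : Set ℝ) : Prop :=
  Tendsto (fun n => diagonalMoment (φ n) (ev n) (K n) (averageOp (ρ n) T (K n)) I) atTop (𝓝 0)

/-- Small-scale quantum mixing in `I`: for all `E₁, E₂` in the interior of `I`, the limit as
`η → 0⁺` of the limsup over `n` of the mixed moments over the windows `[E₁ - η, E₁ + η]` and
`[E₂ - η, E₂ + η]` is zero. -/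
def SmallScaleQuantumMixing (T : Finset Γ) (ρ : (n : ℕ) → Γ →* Equiv.Perm (Fin (N n)))
    (φ : (n : ℕ) → OrthonormalBasis (Fin (N n)) ℂ (EuclideanSpace ℂ (Fin (N n))))
    (ev : (n : ℕ) → Fin (N n) → ℝ)
    (K : (n : ℕ) → Matrix (Fin (N n)) (Fin (N n)) ℂ) (I : Set ℝ) : Prop :=
  ∀ E₁ ∈ interior I, ∀ E₂ ∈ interior I,
    Tendsto (fun η : ℝ => limsup (fun n => ENNReal.ofReal
        (mixedMoment (φ n) (ev n) (K n) (averageOp (ρ n) T (K n))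
          (Set.Icc (E₁ - η) (E₁ + η)) (Set.Icc (E₂ - η) (E₂ + η)))) atTop)
      (𝓝[>] 0) (𝓝 0)

end Sequences

end SchreierMixing

end

/-! Dominate the indicators of the windows of half-width `η` around `E₁`, `E₂` by `2ηq` and `2ηr`,
where `q`, `r` are polynomials slightly above Poisson kernels of width `η`. The sum of squared
matrix elements of a matrix `B` between the windows is then at most `4η² Tr(B* r(P_N) B q(P_N))`.
Since `q(p)` and `r(p)` lie in the group algebra, this trace is a finite combination of traces of
permutation matrices and diagonal matrices, and no infinite-volume functional calculus has to be
transferred to `P_N`.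

By locality, `K_N - ⟨K_N⟩` is a sum of terms `B = ρ(t) diag(c)`. For one term, the pairs `(g, h)`
with `t⁻¹htg ≠ 1` contribute `o(N)` by convergence in distribution; the remaining pairs give the
correlations of `c` with its translate by `g`, weighted by `q(p)_g r(p)_{tg⁻¹t⁻¹}`
(`norm_trace_le`). Outside a finite set `F` of `g` the correlation is at most about `εN`, and the
weights are summed by their `ℓ²` norms, of squared size `O(1/η)`; on `F` each weight is `O(1)`. Both
bounds come from the upper bound on the resolvent (`exists_majorant_polynomial`). Hence the window
sum is `O(Nη(η|F| + ε))` (`eventually_windowSum_le`).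

The lower bound on the resolvent, together with the upper one, yields a polynomial minorant of a
window and so at least a constant times `Nη` eigenvalues in it (`eventually_le_card_indexSet`). The
quotient is `O(η|F| + ε)`: choosing `ε`, then `F`, then `η` gives mixing. For ergodicity, cover `I`
by about `1/η` windows and bound the diagonal terms in each by the whole window sum; the total is
`O(N(η|F| + ε))`, against a number of eigenvalues in `I` of order at least `N`. -/

noncomputable section

namespace SchreierMixing

/-! ### Dirac functions in `ℓ²(Γ)` -/

section Dirac

variable {Γ : Type*}

open Classical in
/-- The Dirac function at `g`. -/
def dirac (g : Γ) : L2 Γ := lp.single 2 g (1 : ℂ)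

theorem dirac_apply (g v : Γ) : (dirac g : Γ → ℂ) v = Set.indicator {g} 1 v := by
  classical
  rw [dirac, lp.single_apply]
  by_cases h : v = g <;> simp [h]

theorem inner_dirac_left (g : Γ) (f : L2 Γ) : inner ℂ (dirac g) f = (f : Γ → ℂ) g := by
  classical
  rw [dirac, lp.inner_single_left]
  simp

theorem inner_dirac_dirac (g h : Γ) :
    inner ℂ (dirac g) (dirac h : L2 Γ) = Set.indicator {h} 1 g := by
  rw [inner_dirac_left, dirac_apply]

theorem orthonormal_dirac : Orthonormal ℂ (dirac : Γ → L2 Γ) := by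
  classical
  rw [orthonormal_iff_ite]
  intro g h
  rw [inner_dirac_dirac]
  simp [Set.indicator_apply]

end Dirac

/-! ### Real polynomials of a self-adjoint operator -/

section RealPolynomials

open Polynomial

variable {H : Type*} [NormedAddCommGroup H] [InnerProductSpace ℂ H]

/-- Evaluation of real polynomials at a bounded operator. -/
def realAeval (A : H →L[ℂ] H) : ℝ[X] →+* (H →L[ℂ] H) :=
  ((aeval A : ℂ[X] →ₐ[ℂ] (H →L[ℂ] H)) : ℂ[X] →+* (H →L[ℂ] H)).comp
    (mapRingHom (algebraMap ℝ ℂ))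

theorem realAeval_X (A : H →L[ℂ] H) : realAeval A X = A := by
  simp [realAeval]

theorem realAeval_C (A : H →L[ℂ] H) (c : ℝ) : realAeval A (C c) = (c : ℂ) • 1 := by
  simp [realAeval, Algebra.algebraMap_eq_smul_one]

theorem realAeval_eq_aeval (A : H →L[ℂ] H) (q : ℝ[X]) : realAeval A q = aeval A q := by
  simp [realAeval, aeval_map_algebraMap]

theorem map_aeval_eq_realAeval {B : Type*} [Ring B] [Algebra ℂ B] [Algebra ℝ B]
    [IsScalarTower ℝ ℂ B] (F : B →ₐ[ℂ] (H →L[ℂ] H)) (p : B) (q : ℝ[X]) :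
    F (aeval p q) = realAeval (F p) q := by
  rw [← aeval_map_algebraMap ℂ, ← aeval_algHom_apply]
  rfl

variable [CompleteSpace H]

theorem isSelfAdjoint_realAeval {A : H →L[ℂ] H} (hA : IsSelfAdjoint A) (q : ℝ[X]) :
    IsSelfAdjoint (realAeval A q) := by
  rw [realAeval_eq_aeval, ← cfc_polynomial q A]
  exact cfc_predicate _ A

theorem re_inner_realAeval_nonneg {A : H →L[ℂ] H} (hA : IsSelfAdjoint A) {M : ℝ} (hM : ‖A‖ ≤ M)
    {q : ℝ[X]} (hq : ∀ x ∈ Set.Icc (-M) M, 0 ≤ q.eval x) (v : H) :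
    0 ≤ (inner ℂ v (realAeval A q v)).re := by
  have h : 0 ≤ realAeval A q := by
    rw [realAeval_eq_aeval, ← cfc_polynomial q A]
    refine cfc_nonneg fun x hx => hq x ?_
    rcases subsingleton_or_nontrivial H with hs | hs
    · have : Subsingleton (H →L[ℂ] H) := inferInstance
      simp [spectrum.of_subsingleton] at hx
    · have := (spectrum.norm_le_norm_of_mem hx).trans hM
      exact abs_le.mp this
  rw [ContinuousLinearMap.nonneg_iff_isPositive] at h
  exact h.re_inner_nonneg_right v

end RealPolynomials

/-! ### The regular representation of the group algebra -/

section Operators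

variable {Γ : Type*} [Group Γ]

theorem diracOne_eq : (diracOne : L2 Γ) = dirac 1 := rfl

theorem leftRegular_apply (g : Γ) (f : L2 Γ) (v : Γ) :
    (leftRegular g f : Γ → ℂ) v = (f : Γ → ℂ) (g⁻¹ * v) := rfl

theorem leftRegular_dirac (g h : Γ) : leftRegular g (dirac h) = dirac (g * h) := by
  classical
  ext v
  rw [leftRegular_apply, dirac_apply, dirac_apply]
  simp only [Set.indicator_apply, Set.mem_singleton_iff, inv_mul_eq_iff_eq_mul, Pi.one_apply]

theorem norm_leftRegular_apply (g : Γ) (f : L2 Γ) : ‖leftRegular g f‖ = ‖f‖ := by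
  rw [lp.norm_eq_tsum_rpow (by norm_num), lp.norm_eq_tsum_rpow (by norm_num)]
  congr 1
  exact (Equiv.mulLeft g⁻¹).tsum_eq (fun v => ‖(f : Γ → ℂ) v‖ ^ (2 : ℝ≥0∞).toReal)

variable (Γ) in
/-- The left regular representation as a monoid homomorphism. -/
def leftRegularHom : Γ →* (L2 Γ →L[ℂ] L2 Γ) where
  toFun := leftRegular
  map_one' := by
    ext f v
    simp [leftRegular_apply]
  map_mul' g h := by
    ext f v
    simp [leftRegular_apply, mul_assoc]

variable (Γ) in
/-- The left regular representation of the group algebra. -/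
def regularRep : MonoidAlgebra ℂ Γ →ₐ[ℂ] (L2 Γ →L[ℂ] L2 Γ) :=
  MonoidAlgebra.lift ℂ _ Γ (leftRegularHom Γ)

theorem regularRep_apply (p : MonoidAlgebra ℂ Γ) : regularRep Γ p = regularOp p := by
  rw [regularRep, MonoidAlgebra.lift_apply]
  rfl

theorem inner_regularRep_dirac (w : MonoidAlgebra ℂ Γ) (g h : Γ) :
    inner ℂ (dirac g) (regularRep Γ w (dirac h)) = w.coeff (g * h⁻¹) := by
  classical
  rw [regularRep_apply, regularOp, sum_apply, inner_sum]
  simp only [_root_.smul_apply, inner_smul_right, leftRegular_dirac,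
    inner_dirac_dirac, Set.indicator_apply, Set.mem_singleton_iff, Pi.one_apply, mul_ite, mul_one,
    mul_zero, ← mul_inv_eq_iff_eq_mul]
  rw [Finset.sum_ite_eq]
  simp +contextual [eq_comm]

theorem adjoint_leftRegular (g : Γ) : star (leftRegular g) = leftRegular g⁻¹ := by
  rw [ContinuousLinearMap.star_eq_adjoint, eq_comm, ContinuousLinearMap.eq_adjoint_iff]
  intro x y
  rw [lp.inner_eq_tsum, lp.inner_eq_tsum, ← (Equiv.mulLeft g⁻¹).tsum_eq]
  simp [leftRegular_apply]

theorem isSelfAdjoint_regularRep {p : MonoidAlgebra ℂ Γ} (hp : IsSelfAdjointElement p) :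
    IsSelfAdjoint (regularRep Γ p) := by
  rw [regularRep_apply, IsSelfAdjoint, regularOp, star_sum]
  simp only [star_smul, adjoint_leftRegular]
  refine Finset.sum_bij (fun g _ => g⁻¹) ?_ ?_ ?_ ?_
  · intro g hg
    simpa [hp g] using hg
  · simp
  · intro g hg
    exact ⟨g⁻¹, by simpa [hp g] using hg, by simp⟩
  · intro g _
    rw [hp g]
    rfl

/-- The `ℓ¹` norm of the coefficients. -/
def coeffNorm (p : MonoidAlgebra ℂ Γ) : ℝ := ∑ g ∈ p.coeff.support, ‖p.coeff g‖

theorem norm_regularRep_le (p : MonoidAlgebra ℂ Γ) : ‖regularRep Γ p‖ ≤ coeffNorm p := by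
  rw [regularRep_apply, regularOp]
  refine norm_sum_le_of_le _ fun g _ => ?_
  rw [norm_smul]
  refine mul_le_of_le_one_right (norm_nonneg _) ?_
  exact ContinuousLinearMap.opNorm_le_bound _ zero_le_one fun f => by
    rw [norm_leftRegular_apply, one_mul]

end Operators

/-! ### Coefficients of `q(p)` and the resolvent; polynomial majorants and minorants of windows -/

section SpectralPolynomials

open Polynomial

variable {Γ : Type*} [Group Γ]

/-- The real part of the coefficient at `1` of `q(p)`: the normalized trace of `q(λ(p))`. -/
def unitTrace (p : MonoidAlgebra ℂ Γ) : ℝ[X] →ₗ[ℝ] ℝ where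
  toFun q := ((aeval p q).coeff 1).re
  map_add' q r := by simp
  map_smul' c q := by simp

theorem unitTrace_apply (p : MonoidAlgebra ℂ Γ) (q : ℝ[X]) :
    unitTrace p q = ((aeval p q).coeff 1).re := rfl

theorem unitTrace_C (p : MonoidAlgebra ℂ Γ) (c : ℝ) : unitTrace p (C c) = c := by
  have h : (C c : ℝ[X]) = c • 1 := by rw [smul_eq_C_mul, mul_one]
  rw [h, map_smul, unitTrace_apply, map_one (aeval p)]
  simp [MonoidAlgebra.one_def, MonoidAlgebra.coeff_single]

theorem unitTrace_eq_inner (p : MonoidAlgebra ℂ Γ) (q : ℝ[X]) :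
    unitTrace p q = (inner ℂ (dirac 1) (realAeval (regularRep Γ p) q (dirac 1))).re := by
  rw [← map_aeval_eq_realAeval, inner_regularRep_dirac]
  simp [unitTrace_apply]

variable {p : MonoidAlgebra ℂ Γ} (hp : IsSelfAdjointElement p)
include hp

theorem unitTrace_nonneg {q : ℝ[X]}
    (hq : ∀ x ∈ Set.Icc (-coeffNorm p) (coeffNorm p), 0 ≤ q.eval x) : 0 ≤ unitTrace p q := by
  rw [unitTrace_eq_inner]
  exact re_inner_realAeval_nonneg (isSelfAdjoint_regularRep hp) (norm_regularRep_le p) hq _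

theorem conj_coeff_aeval (q : ℝ[X]) (g : Γ) :
    conj ((aeval p q).coeff g) = (aeval p q).coeff g⁻¹ := by
  have h := (isSelfAdjoint_realAeval (isSelfAdjoint_regularRep hp) q).isSymmetric (dirac 1) (dirac g)
  rw [ContinuousLinearMap.coe_coe, ← map_aeval_eq_realAeval, inner_regularRep_dirac,
    ← inner_conj_symm, inner_regularRep_dirac] at h
  simpa using h

/-- An off-diagonal entry of a positive operator is controlled by its diagonal entries, and all
diagonal entries of `q(λ(p))` equal the trace. Positivity is tested on `δ_e` minus a unimodular
multiple of `δ_g`, with the phase aligned to the coefficient. -/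
theorem norm_coeff_aeval_le {q : ℝ[X]}
    (hq : ∀ x ∈ Set.Icc (-coeffNorm p) (coeffNorm p), 0 ≤ q.eval x) (g : Γ) :
    ‖(aeval p q).coeff g‖ ≤ unitTrace p q := by
  obtain ⟨c, hc, hcw⟩ : ∃ c : ℂ, ‖c‖ = 1 ∧ c * (aeval p q).coeff g = ‖(aeval p q).coeff g‖ := by
    obtain ⟨c, hc, h⟩ := RCLike.exists_norm_eq_mul_self ((aeval p q).coeff g)
    exact ⟨c, hc, h.symm⟩
  have h := re_inner_realAeval_nonneg (isSelfAdjoint_regularRep hp) (norm_regularRep_le p) hq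
    (dirac 1 - conj c • dirac g)
  have hcc : c * conj c = 1 := by
    rw [Complex.mul_conj, Complex.normSq_eq_norm_sq, hc]; simp
  rw [← map_aeval_eq_realAeval, map_sub, map_smul, inner_sub_left, inner_sub_right, inner_sub_right,
    inner_smul_right, inner_smul_left, inner_smul_left, inner_smul_right] at h
  simp only [inner_regularRep_dirac, one_mul, mul_one, inv_one, Complex.conj_conj,
    ← conj_coeff_aeval hp, ← map_mul, hcw, mul_inv_cancel, ← mul_assoc, hcc] at h
  simp only [Complex.sub_re, Complex.conj_ofReal, Complex.ofReal_re, ← unitTrace_apply] at h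
  linarith

/-- Bessel's inequality for `q(λ(p)) δ_e`, whose squared norm is the `(e, e)` entry of `q(λ(p))²`.
-/
theorem sum_norm_coeff_aeval_sq_le (q : ℝ[X]) (s : Finset Γ) :
    ∑ g ∈ s, ‖(aeval p q).coeff g‖ ^ 2 ≤ unitTrace p (q * q) := by
  have h := orthonormal_dirac.sum_inner_products_le (s := s)
    (regularRep Γ (aeval p q) (dirac (1 : Γ)))
  simp only [inner_regularRep_dirac, inv_one, mul_one] at h
  refine h.trans (le_of_eq ?_)
  have hs := (isSelfAdjoint_realAeval (isSelfAdjoint_regularRep hp) q).isSymmetric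
    (dirac 1) (realAeval (regularRep Γ p) q (dirac 1))
  rw [unitTrace_eq_inner, map_mul, mul_apply_eq_comp, map_aeval_eq_realAeval,
    ← inner_self_eq_norm_sq (𝕜 := ℂ)]
  exact congrArg Complex.re hs

/-- This compares `q` with a multiple of the Poisson kernel without the spectral measure. Put `D =
λ(p) - z` and `v = D⁻¹δ_e`, so that `D*D = (λ(p) - E)² + η²`. Since `q(λ(p))` commutes with `D*`,
the quadratic form of `q · ((x - E)² + η²)` at `v` is that of `q` at `δ_e`, while `η‖v‖² = Im⟨δ_e,
v⟩`. The claim is positivity of a polynomial of `λ(p)` at `v`. -/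
theorem unitTrace_add_mul_imResolvent_nonneg {E η : ℝ} (hη : 0 < η) (c : ℝ) {q : ℝ[X]}
    (hq : ∀ x ∈ Set.Icc (-coeffNorm p) (coeffNorm p),
      0 ≤ q.eval x * ((x - E) ^ 2 + η ^ 2) + c * η) :
    0 ≤ unitTrace p q + c * imResolventAtOne p ((E : ℂ) + (η : ℂ) * Complex.I) := by
  set z : ℂ := (E : ℂ) + (η : ℂ) * Complex.I with hz
  have hzim : z.im = η := by simp [hz]
  set A := regularRep Γ p with hA
  have hsa : IsSelfAdjoint A := isSelfAdjoint_regularRep hp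
  have hunit : IsUnit (A - z • (1 : L2 Γ →L[ℂ] L2 Γ)) := by
    have hns : z ∉ spectrum ℂ A := fun h => by
      have := hsa.im_eq_zero_of_mem_spectrum h
      linarith
    rw [spectrum.notMem_iff, ← IsUnit.neg_iff, Algebra.algebraMap_eq_smul_one] at hns
    simpa using hns
  set D := A - z • (1 : L2 Γ →L[ℂ] L2 Γ) with hD
  set v := resolventOp A z (dirac 1) with hv
  have hDv : D v = dirac 1 := by
    rw [hv, resolventOp, ← mul_apply_eq_comp, Ring.mul_inverse_cancel _ hunit]
    rfl
  have hDstar : star D = A - conj z • (1 : L2 Γ →L[ℂ] L2 Γ) := by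
    simp [hD, hsa.star_eq]
  have hcomm : Commute (realAeval A q) (star D) := by
    have hX : Commute (realAeval A q) A := by
      have := (Commute.all q X).map (realAeval A)
      rwa [realAeval_X] at this
    rw [hDstar]
    exact hX.sub_right ((Commute.one_right _).smul_right _)
  have hquad : realAeval A ((X - C E) ^ 2 + C (η ^ 2) : ℝ[X]) = star D * D := by
    have h1 : conj z = E - η * Complex.I := by simp [hz, sub_eq_add_neg]
    have h2 : ((X - C E) ^ 2 + C (η ^ 2) : ℝ[X]).map (algebraMap ℝ ℂ)
        = (X - C (conj z)) * (X - C z) := by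
      have hI : (C Complex.I : ℂ[X]) * C Complex.I = -1 := by
        rw [← C_mul, Complex.I_mul_I, C_neg, C_1]
      rw [h1, hz]
      simp only [Polynomial.map_add, Polynomial.map_pow, Polynomial.map_sub, map_X, map_C,
        Complex.coe_algebraMap, C_add, C_sub, C_mul, C_pow]
      linear_combination (C (η : ℂ)) ^ 2 * hI
    rw [realAeval, RingHom.comp_apply, coe_mapRingHom, h2, hDstar, hD]
    simp [Algebra.algebraMap_eq_smul_one]
  have hQ := re_inner_realAeval_nonneg hsa (norm_regularRep_le p)
    (q := q * ((X - C E) ^ 2 + C (η ^ 2)) + C (c * η)) (by simpa using hq) v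
  have h1 : inner ℂ v (realAeval A (q * ((X - C E) ^ 2 + C (η ^ 2))) v)
      = inner ℂ (dirac 1) (realAeval A q (dirac 1)) := by
    rw [map_mul, hquad, ← mul_assoc, hcomm.eq, mul_assoc, mul_apply_eq_comp,
      mul_apply_eq_comp, hDv, ContinuousLinearMap.star_eq_adjoint,
      ContinuousLinearMap.adjoint_inner_right, hDv]
  have h2 : (inner ℂ (dirac (1 : Γ)) v).im = η * ‖v‖ ^ 2 := by
    have hAv := hsa.isSymmetric.im_inner_apply_self v
    have hz2 : inner ℂ (z • v) v = conj z * (‖v‖ : ℂ) ^ 2 := by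
      rw [inner_smul_left, inner_self_eq_norm_sq_to_K]
      rfl
    rw [← hDv, hD, _root_.sub_apply, _root_.smul_apply, one_apply_eq_self,
      inner_sub_left, hz2, Complex.sub_im]
    have h4 : (inner ℂ (A v) v).im = 0 := hAv
    rw [h4, ← Complex.ofReal_pow, Complex.im_mul_ofReal, Complex.conj_im, hzim]
    ring
  have h3 : (inner ℂ v (realAeval A (C (c * η) : ℝ[X]) v)).re = c * η * ‖v‖ ^ 2 := by
    rw [realAeval_C, _root_.smul_apply, inner_smul_right, one_apply_eq_self,
      inner_self_eq_norm_sq_to_K]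
    rw [Complex.re_ofReal_mul]
    norm_cast
  rw [map_add, _root_.add_apply, inner_add_right, Complex.add_re, h1, h3] at hQ
  rw [unitTrace_eq_inner, imResolventAtOne, ← regularRep_apply, diracOne_eq, ← hA, ← hv, h2]
  linarith

theorem exists_polynomial_above_poissonKernel {E η δ : ℝ} (hη : 0 < η) (hδ : 0 < δ) :
    ∃ q : ℝ[X], (∀ x ∈ Set.Icc (-coeffNorm p) (coeffNorm p),
        η / ((x - E) ^ 2 + η ^ 2) ≤ q.eval x ∧ q.eval x ≤ η / ((x - E) ^ 2 + η ^ 2) + δ) ∧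
      imResolventAtOne p ((E : ℂ) + (η : ℂ) * Complex.I) ≤ unitTrace p q ∧
      unitTrace p q ≤ imResolventAtOne p ((E : ℂ) + (η : ℂ) * Complex.I) + δ := by
  have hpos : ∀ x : ℝ, 0 < (x - E) ^ 2 + η ^ 2 := fun x => by positivity
  -- Approximating the kernel shifted up by `δ/2`, to within `δ/2`, makes the approximation
  -- one-sided.
  obtain ⟨q, hq⟩ := exists_polynomial_near_of_continuousOn (-coeffNorm p) (coeffNorm p)
    (fun x => η / ((x - E) ^ 2 + η ^ 2) + δ / 2)
    (Continuous.continuousOn (by fun_prop (disch := intro x; exact (hpos x).ne'))) (δ / 2)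
    (by positivity)
  have hb : ∀ x ∈ Set.Icc (-coeffNorm p) (coeffNorm p),
      η / ((x - E) ^ 2 + η ^ 2) ≤ q.eval x ∧ q.eval x ≤ η / ((x - E) ^ 2 + η ^ 2) + δ := by
    intro x hx
    have := abs_lt.mp (hq x hx)
    constructor <;> linarith
  refine ⟨q, hb, ?_, ?_⟩
  · have := unitTrace_add_mul_imResolvent_nonneg hp (E := E) hη (-1) (q := q) fun x hx => by
      have := (div_le_iff₀ (hpos x)).mp (hb x hx).1
      linarith
    linarith
  · have := unitTrace_add_mul_imResolvent_nonneg hp (E := E) hη 1 (q := C δ - q) fun x hx => by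
      have h := mul_le_mul_of_nonneg_right (hb x hx).2 (hpos x).le
      rw [add_mul, div_mul_cancel₀ _ (hpos x).ne'] at h
      rw [eval_sub, eval_C]
      linarith
    rw [map_sub, unitTrace_C] at this
    linarith

/-- The kernel is at least `1/(2η)` on the window. The error `1 ≤ C₀` makes the trace at most `2C₀`,
which bounds every coefficient. Also `0 ≤ q ≤ 1/η + 1 ≤ 2/η`, so `q² ≤ (2/η)q`, which turns the
trace bound into the `ℓ²` bound. -/
theorem exists_majorant_polynomial {C₀ : ℝ} (hC₀ : 1 ≤ C₀) {E η : ℝ} (hη : 0 < η) (hη1 : η ≤ 1)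
    (hE : imResolventAtOne p ((E : ℂ) + (η : ℂ) * Complex.I) ≤ C₀) :
    ∃ q : ℝ[X], (∀ x ∈ Set.Icc (-coeffNorm p) (coeffNorm p), 0 ≤ q.eval x) ∧
      (∀ x ∈ Set.Icc (-coeffNorm p) (coeffNorm p), x ∈ Set.Icc (E - η) (E + η) →
        1 ≤ 2 * η * q.eval x) ∧
      (∀ g, ‖(aeval p q).coeff g‖ ≤ 2 * C₀) ∧
      ∀ s : Finset Γ, ∑ g ∈ s, ‖(aeval p q).coeff g‖ ^ 2 ≤ 4 * C₀ / η := by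
  obtain ⟨q, hq, -, hq2⟩ :=
    exists_polynomial_above_poissonKernel hp (E := E) hη (δ := 1) one_pos
  have hq0 : ∀ x ∈ Set.Icc (-coeffNorm p) (coeffNorm p), 0 ≤ q.eval x := fun x hx =>
    le_trans (by positivity) (hq x hx).1
  have hqC : unitTrace p q ≤ 2 * C₀ := by linarith
  refine ⟨q, hq0, ?_, fun g => (norm_coeff_aeval_le hp hq0 g).trans hqC, fun s => ?_⟩
  · intro x hx hxE
    have h1 : (x - E) ^ 2 + η ^ 2 ≤ 2 * η ^ 2 := by
      have : (x - E) ^ 2 ≤ η ^ 2 := sq_le_sq' (by linarith [hxE.1]) (by linarith [hxE.2])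
      linarith
    have h2 : η / (2 * η ^ 2) ≤ q.eval x :=
      le_trans (div_le_div_of_nonneg_left hη.le (by positivity) h1) (hq x hx).1
    calc (1 : ℝ) = 2 * η * (η / (2 * η ^ 2)) := by field_simp
      _ ≤ _ := by gcongr
  · refine (sum_norm_coeff_aeval_sq_le hp q s).trans ?_
    have h := unitTrace_nonneg hp (q := C (2 / η) * q - q * q) fun x hx => by
      have h1 : η / ((x - E) ^ 2 + η ^ 2) ≤ 1 / η := by
        rw [div_le_div_iff₀ (by positivity) hη]
        nlinarith [sq_nonneg (x - E)]
      have h2 : q.eval x ≤ 2 / η := by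
        have h3 : 1 ≤ 1 / η := by rw [le_div_iff₀ hη]; linarith
        have h4 : 2 / η = 1 / η + 1 / η := by ring
        linarith [(hq x hx).2]
      simp only [eval_sub, eval_mul, eval_C]
      nlinarith [hq0 x hx]
    rw [map_sub, ← smul_eq_C_mul, map_smul, smul_eq_mul] at h
    calc unitTrace p (q * q) ≤ 2 / η * unitTrace p q := by linarith
      _ ≤ 2 / η * (2 * C₀) := by gcongr
      _ = _ := by ring

/-- A Poisson kernel of smaller width `s`, minus `2s/η` times the kernel of width `η`, is
nonpositive outside the window, because `(x - E)² + η² ≤ 2(x - E)²` there. Multiplication by `s`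
normalises its height to at most `1`. -/
theorem exists_minorant_polynomial {C₀ : ℝ} (hC₀ : 1 ≤ C₀) {E : ℝ}
    (hE : ∀ η : ℝ, 0 < η → η ≤ 1 →
      C₀⁻¹ ≤ imResolventAtOne p ((E : ℂ) + (η : ℂ) * Complex.I) ∧
      imResolventAtOne p ((E : ℂ) + (η : ℂ) * Complex.I) ≤ C₀)
    {η : ℝ} (hη : 0 < η) (hη1 : η ≤ 1) :
    ∃ q : ℝ[X], (∀ x ∈ Set.Icc (-coeffNorm p) (coeffNorm p), q.eval x ≤ 1) ∧
      (∀ x ∈ Set.Icc (-coeffNorm p) (coeffNorm p), x ∉ Set.Icc (E - η) (E + η) →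
        q.eval x ≤ 0) ∧ η / (16 * C₀ ^ 3) ≤ unitTrace p q := by
  have hC : 0 < C₀ := by linarith
  -- With this width `2s/η = 1/(2C₀²)`: the subtracted kernel has trace about `1/(2C₀)` at most,
  -- half of the lower bound `1/C₀` for the narrow one. The errors `δ` still leave `1/(4C₀)`.
  obtain ⟨s, hs⟩ : ∃ s, s = η / (4 * C₀ ^ 2) := ⟨_, rfl⟩
  have hs0 : 0 < s := by rw [hs]; positivity
  have hsη : s ≤ η := by
    rw [hs]; exact div_le_self hη.le (by nlinarith)
  have hsr : 2 * s / η = 1 / (2 * C₀ ^ 2) := by rw [hs]; field_simp; norm_num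
  obtain ⟨δ, hδ⟩ : ∃ δ, δ = 1 / (8 * C₀) := ⟨_, rfl⟩
  have hδ0 : 0 < δ := by rw [hδ]; positivity
  obtain ⟨q₁, hq₁, hl₁, -⟩ := exists_polynomial_above_poissonKernel hp (E := E) hs0 hδ0
  obtain ⟨q₂, hq₂, -, hu₂⟩ := exists_polynomial_above_poissonKernel hp (E := E) hη hδ0
  have hb₁ := (hE s hs0 (hsη.trans hη1)).1
  have hb₂ := (hE η hη hη1).2
  refine ⟨C s * (q₁ - C δ - C (2 * s / η) * q₂), ?_, ?_, ?_⟩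
  · intro x hx
    have h1 : q₁.eval x - δ ≤ 1 / s := by
      have : s / ((x - E) ^ 2 + s ^ 2) ≤ 1 / s := by
        rw [div_le_div_iff₀ (by positivity) hs0]
        nlinarith [sq_nonneg (x - E)]
      linarith [(hq₁ x hx).2]
    have h2 : 0 ≤ 2 * s / η * q₂.eval x :=
      mul_nonneg (by positivity) (le_trans (by positivity) (hq₂ x hx).1)
    simp only [eval_sub, eval_mul, eval_C]
    calc _ ≤ s * (1 / s) := by gcongr; linarith
      _ = 1 := by field_simp
  · intro x hx hxE
    have hsq : η ^ 2 ≤ (x - E) ^ 2 := by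
      rw [sq_le_sq, abs_of_pos hη, le_abs]
      by_contra! h
      exact hxE ⟨by linarith, by linarith⟩
    have h1 : s / ((x - E) ^ 2 + s ^ 2) ≤ 2 * s / η * (η / ((x - E) ^ 2 + η ^ 2)) := by
      have h3 : 2 * s / η * (η / ((x - E) ^ 2 + η ^ 2)) = 2 * s / ((x - E) ^ 2 + η ^ 2) := by
        field_simp
      have hx0 : 0 < (x - E) ^ 2 := by nlinarith
      rw [h3, div_le_div_iff₀ (by positivity) (by positivity)]
      nlinarith [mul_pos hs0 hs0]
    have h2 : 2 * s / η * (η / ((x - E) ^ 2 + η ^ 2)) ≤ 2 * s / η * q₂.eval x := by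
      gcongr
      exact (hq₂ x hx).1
    simp only [eval_sub, eval_mul, eval_C]
    exact mul_nonpos_of_nonneg_of_nonpos hs0.le (by linarith [(hq₁ x hx).2])
  · rw [← smul_eq_C_mul, ← smul_eq_C_mul, map_smul, map_sub, map_sub, map_smul, unitTrace_C,
      smul_eq_mul, smul_eq_mul, hsr]
    have h1 : 1 / (2 * C₀ ^ 2) * unitTrace p q₂ ≤ 1 / (2 * C₀ ^ 2) * (C₀ + δ) := by
      gcongr
      linarith
    have h2 : 1 / (2 * C₀ ^ 2) * (C₀ + δ) ≤ 1 / (2 * C₀) + 1 / (16 * C₀) := by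
      have h4 : 1 / (2 * C₀ ^ 2) * (C₀ + δ) = 1 / (2 * C₀) + 1 / (16 * C₀ ^ 3) := by
        rw [hδ]; field_simp; ring
      have h5 : 1 / (16 * C₀ ^ 3) ≤ 1 / (16 * C₀) := by
        gcongr
        nlinarith [sq_nonneg C₀]
      linarith
    have h3 : 1 / (4 * C₀) ≤ unitTrace p q₁ - δ - 1 / (2 * C₀ ^ 2) * unitTrace p q₂ := by
      have h6 : C₀⁻¹ - δ - (1 / (2 * C₀) + 1 / (16 * C₀)) = 5 / (16 * C₀) := by
        rw [hδ]; field_simp; norm_num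
      have h7 : 1 / (4 * C₀) ≤ 5 / (16 * C₀) := by
        rw [div_le_div_iff₀ (by positivity) (by positivity)]; linarith
      linarith
    calc η / (16 * C₀ ^ 3) = s * (1 / (4 * C₀)) := by rw [hs]; field_simp; norm_num
      _ ≤ _ := by gcongr

end SpectralPolynomials

/-! ### Permutation matrices and the induced representation of the group algebra -/

section PermutationMatrices

variable {Γ : Type*} [Group Γ] {N : ℕ}

theorem permMatrix_mulVec (ρ : Γ →* Equiv.Perm (Fin N)) (g : Γ) (v : Fin N → ℂ) (x : Fin N) :
    (permMatrix ρ g).mulVec v x = v (ρ g⁻¹ x) := by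
  have h : ∀ y, x = ρ g y ↔ ρ g⁻¹ x = y := fun y => by rw [map_inv, Equiv.Perm.inv_eq_iff_eq]
  simp [permMatrix, Matrix.mulVec, dotProduct, h, -map_inv]

/-- The permutation matrices of `ρ` as a monoid homomorphism. -/
def permMatrixHom (ρ : Γ →* Equiv.Perm (Fin N)) : Γ →* Matrix (Fin N) (Fin N) ℂ where
  toFun := permMatrix ρ
  map_one' := by
    ext x y
    simp [permMatrix, Matrix.one_apply]
  map_mul' g h := by
    ext x y
    simp [permMatrix, Matrix.mul_apply]

theorem permMatrix_mul (ρ : Γ →* Equiv.Perm (Fin N)) (g h : Γ) :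
    permMatrix ρ (g * h) = permMatrix ρ g * permMatrix ρ h :=
  map_mul (permMatrixHom ρ) g h

theorem conjTranspose_permMatrix (ρ : Γ →* Equiv.Perm (Fin N)) (g : Γ) :
    (permMatrix ρ g).conjTranspose = permMatrix ρ g⁻¹ := by
  ext x y
  have h : x = ρ g⁻¹ y ↔ y = ρ g x := by
    rw [map_inv, Equiv.Perm.eq_inv_iff_eq, eq_comm]
  simp only [permMatrix, Matrix.conjTranspose_apply, Matrix.of_apply, h]
  split_ifs <;> simp

/-- The representation of the group algebra defined by `ρ`. -/
def permRep (ρ : Γ →* Equiv.Perm (Fin N)) :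
    MonoidAlgebra ℂ Γ →ₐ[ℂ] Matrix (Fin N) (Fin N) ℂ :=
  MonoidAlgebra.lift ℂ _ Γ (permMatrixHom ρ)

theorem permRep_apply (ρ : Γ →* Equiv.Perm (Fin N)) (w : MonoidAlgebra ℂ Γ) :
    permRep ρ w = ∑ g ∈ w.coeff.support, w.coeff g • permMatrix ρ g := by
  rw [permRep, MonoidAlgebra.lift_apply]
  rfl

theorem permRep_aeval (ρ : Γ →* Equiv.Perm (Fin N)) (p : MonoidAlgebra ℂ Γ)
    (q : Polynomial ℝ) :
    permRep ρ (Polynomial.aeval p q) = Polynomial.aeval (schreierOp ρ p) q := by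
  rw [schreierOp, ← permRep_apply]
  exact (Polynomial.aeval_algHom_apply ((permRep ρ).restrictScalars ℝ) p q).symm

/-- The number of fixed points of `ρ(g)`. -/
def fixCount (ρ : Γ →* Equiv.Perm (Fin N)) (g : Γ) : ℕ :=
  (Finset.univ.filter fun x => ρ g x = x).card

theorem trace_permMatrix (ρ : Γ →* Equiv.Perm (Fin N)) (g : Γ) :
    (permMatrix ρ g).trace = fixCount ρ g := by
  simp [permMatrix, Matrix.trace, fixCount, eq_comm]

theorem norm_toEuclideanLin_permMatrix (ρ : Γ →* Equiv.Perm (Fin N)) (g : Γ)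
    (v : EuclideanSpace ℂ (Fin N)) : ‖Matrix.toEuclideanLin (permMatrix ρ g) v‖ = ‖v‖ := by
  rw [EuclideanSpace.norm_eq, EuclideanSpace.norm_eq]
  congr 1
  simp only [Matrix.toLpLin_apply, permMatrix_mulVec]
  exact Equiv.sum_comp (ρ g⁻¹) fun x => ‖v x‖ ^ 2

end PermutationMatrices

/-! ### Traces in an eigenbasis -/

section Eigenbases

open Polynomial

variable {N : ℕ} {A : Matrix (Fin N) (Fin N) ℂ}
  {φ : OrthonormalBasis (Fin N) ℂ (EuclideanSpace ℂ (Fin N))} {ev : Fin N → ℝ}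

theorem trace_eq_sum_matrixElement (φ : OrthonormalBasis (Fin N) ℂ (EuclideanSpace ℂ (Fin N)))
    (B : Matrix (Fin N) (Fin N) ℂ) : B.trace = ∑ α, matrixElement φ B α α := by
  rw [← Matrix.trace_toLin_eq B (EuclideanSpace.basisFun (Fin N) ℂ).toBasis,
    LinearMap.trace_eq_sum_inner _ φ, ← Matrix.toEuclideanLin_eq_toLin_orthonormal]
  rfl

theorem toEuclideanLin_mul_apply (B C : Matrix (Fin N) (Fin N) ℂ)
    (v : EuclideanSpace ℂ (Fin N)) :
    Matrix.toEuclideanLin (B * C) v = Matrix.toEuclideanLin B (Matrix.toEuclideanLin C v) := by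
  simp [Matrix.toLpLin_apply, Matrix.mulVec_mulVec]

theorem IsEigenbasis.toEuclideanLin_aeval (h : IsEigenbasis A φ ev) (q : ℝ[X]) (α : Fin N) :
    Matrix.toEuclideanLin (aeval A q) (φ α) = ((q.eval (ev α) : ℝ) : ℂ) • φ α := by
  induction q using Polynomial.induction_on' with
  | add q r hq hr =>
    rw [map_add, map_add, LinearMap.add_apply, hq, hr, eval_add, Complex.ofReal_add, add_smul]
  | monomial k c =>
    rw [← smul_X_eq_monomial, map_smul, map_pow, aeval_X]
    induction k with
    | zero =>
      ext x
      simp [Matrix.toLpLin_apply, Matrix.smul_mulVec]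
    | succ k ih =>
      rw [pow_succ, ← smul_mul_assoc, toEuclideanLin_mul_apply, h α, map_smul, ih, smul_smul]
      congr 1
      simp
      ring

theorem IsEigenbasis.sum_eval (h : IsEigenbasis A φ ev) (q : ℝ[X]) :
    ∑ α, ((q.eval (ev α) : ℝ) : ℂ) = (aeval A q).trace := by
  rw [trace_eq_sum_matrixElement φ]
  refine Finset.sum_congr rfl fun α _ => ?_
  rw [matrixElement, h.toEuclideanLin_aeval, inner_smul_right,
    inner_self_eq_norm_sq_to_K, φ.norm_eq_one]
  simp

theorem IsEigenbasis.inner_aeval (h : IsEigenbasis A φ ev) (q : ℝ[X])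
    (v : EuclideanSpace ℂ (Fin N)) :
    inner ℂ v (Matrix.toEuclideanLin (aeval A q) v)
      = ∑ β, ((q.eval (ev β) * ‖(inner ℂ (φ β) v : ℂ)‖ ^ 2 : ℝ) : ℂ) := by
  have hv : Matrix.toEuclideanLin (aeval A q) v
      = ∑ β, ((inner ℂ (φ β) v : ℂ) * (q.eval (ev β) : ℝ)) • φ β := by
    conv_lhs => rw [← φ.sum_repr' v]
    simp only [map_sum, map_smul, h.toEuclideanLin_aeval, smul_smul]
  rw [hv, inner_sum]
  refine Finset.sum_congr rfl fun β _ => ?_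
  rw [inner_smul_right, ← inner_conj_symm v, mul_right_comm, Complex.mul_conj,
    Complex.normSq_eq_norm_sq, Complex.ofReal_mul, mul_comm]

/-- Compute the trace in the basis `φ`: `q` acts on `φ α` as a scalar, and the form of `r` at `K φ
α` expands over `φ β`. This turns smoothed window sums into traces of words in the group. -/
theorem IsEigenbasis.sum_eval_mul_eval (h : IsEigenbasis A φ ev) (q r : ℝ[X])
    (K : Matrix (Fin N) (Fin N) ℂ) :
    ((∑ α, ∑ β, q.eval (ev α) * (r.eval (ev β) * ‖matrixElement φ K β α‖ ^ 2) : ℝ) : ℂ)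
      = (K.conjTranspose * aeval A r * K * aeval A q).trace := by
  rw [trace_eq_sum_matrixElement φ, Complex.ofReal_sum]
  refine Finset.sum_congr rfl fun α _ => ?_
  rw [matrixElement, toEuclideanLin_mul_apply, h.toEuclideanLin_aeval, map_smul,
    inner_smul_right, toEuclideanLin_mul_apply, toEuclideanLin_mul_apply,
    Matrix.toEuclideanLin_conjTranspose_eq_adjoint, LinearMap.adjoint_inner_right, h.inner_aeval,
    ← Finset.mul_sum, Complex.ofReal_mul, Complex.ofReal_sum]
  rfl

end Eigenbases

/-! ### Localisation of the eigenvalues -/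

section SchreierEigenvalues

variable {Γ : Type*} [Group Γ] {N : ℕ} {ρ : Γ →* Equiv.Perm (Fin N)} {p : MonoidAlgebra ℂ Γ}
  {φ : OrthonormalBasis (Fin N) ℂ (EuclideanSpace ℂ (Fin N))} {ev : Fin N → ℝ}

/-- The interval is the one used to bound the spectrum of `λ(p)`, so one set of polynomial
inequalities serves both operators. -/
theorem IsEigenbasis.mem_Icc (h : IsEigenbasis (schreierOp ρ p) φ ev) (α : Fin N) :
    ev α ∈ Set.Icc (-coeffNorm p) (coeffNorm p) := by
  rw [Set.mem_Icc, ← abs_le]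
  have h1 : ‖(ev α : ℂ) • φ α‖ ≤ coeffNorm p := by
    rw [← h α, schreierOp, map_sum, LinearMap.sum_apply]
    refine norm_sum_le_of_le _ fun g _ => ?_
    rw [map_smul, LinearMap.smul_apply, norm_smul, norm_toEuclideanLin_permMatrix,
      φ.norm_eq_one, mul_one]
  rwa [norm_smul, φ.norm_eq_one, mul_one, Complex.norm_real, Real.norm_eq_abs] at h1

end SchreierEigenvalues

/-! ### Decomposition of local matrices and correlations of their coefficients -/

section LocalMatrices

variable {Γ : Type*} [Group Γ] {N : ℕ}

/-- The coefficient of `ρ(t)` in a `T`-local matrix, with each entry shared equally among the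
elements of `T` that produce it. -/
def sharedCoeff (ρ : Γ →* Equiv.Perm (Fin N)) (T : Finset Γ) (K : Matrix (Fin N) (Fin N) ℂ)
    (t : Γ) (x : Fin N) : ℂ :=
  localCoeff ρ K t x / ((T.filter fun s => ρ s x = ρ t x).card : ℂ)

/-- The shared coefficient recentered by the average of the local coefficient. -/
def centeredCoeff (ρ : Γ →* Equiv.Perm (Fin N)) (T : Finset Γ) (K : Matrix (Fin N) (Fin N) ℂ)
    (t : Γ) (x : Fin N) : ℂ :=
  sharedCoeff ρ T K t x - average (localCoeff ρ K t)

theorem IsLocal.eq_sum {ρ : Γ →* Equiv.Perm (Fin N)} {T : Finset Γ}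
    {K : Matrix (Fin N) (Fin N) ℂ} (hK : IsLocal ρ T K) :
    K = ∑ t ∈ T, permMatrix ρ t * Matrix.diagonal (sharedCoeff ρ T K t) := by
  ext x y
  rw [Matrix.sum_apply]
  simp only [Matrix.mul_diagonal, permMatrix, Matrix.of_apply, ite_mul, one_mul, zero_mul]
  rw [← Finset.sum_filter]
  have h : ∀ t ∈ T.filter (fun t => x = ρ t y), sharedCoeff ρ T K t y
      = K x y / ((T.filter fun s => x = ρ s y).card : ℂ) := by
    intro t ht
    have hx := (Finset.mem_filter.mp ht).2
    simp only [sharedCoeff, localCoeff, ← hx, eq_comm]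
  rw [Finset.sum_congr rfl h, Finset.sum_const, nsmul_eq_mul]
  by_cases h0 : (T.filter fun s => x = ρ s y).card = 0
  · rw [h0, Nat.cast_zero, zero_mul]
    refine hK x y ?_
    rintro ⟨g, hg, hx⟩
    rw [Finset.card_eq_zero] at h0
    have : g ∈ T.filter fun s => x = ρ s y := Finset.mem_filter.mpr ⟨hg, hx⟩
    simp [h0] at this
  · rw [mul_div_cancel₀]
    exact_mod_cast h0

/-- The identity is exact even when several elements of `T` produce the same entry: sharing avoids
multiple counting, and the subtracted constant is the mean of the unshared coefficient, as in
`averageOp`. -/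
theorem IsLocal.sub_averageOp {ρ : Γ →* Equiv.Perm (Fin N)} {T : Finset Γ}
    {K : Matrix (Fin N) (Fin N) ℂ} (hK : IsLocal ρ T K) :
    K - averageOp ρ T K
      = ∑ t ∈ T, permMatrix ρ t * Matrix.diagonal (centeredCoeff ρ T K t) := by
  have h : K - averageOp ρ T K = ∑ t ∈ T, permMatrix ρ t * Matrix.diagonal (sharedCoeff ρ T K t)
      - averageOp ρ T K := congrArg (· - averageOp ρ T K) hK.eq_sum
  rw [h, averageOp, ← Finset.sum_sub_distrib]
  refine Finset.sum_congr rfl fun t _ => ?_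
  ext x y
  simp only [Matrix.sub_apply, Matrix.mul_diagonal, Matrix.smul_apply, smul_eq_mul,
    centeredCoeff]
  ring

theorem norm_average_le {a : Fin N → ℂ} (ha : ∀ x, ‖a x‖ ≤ 1) : ‖average a‖ ≤ 1 := by
  rw [average, norm_mul, norm_inv, Complex.norm_natCast]
  have h : ‖∑ x, a x‖ ≤ N := (norm_sum_le_of_le _ fun x _ => ha x).trans (by simp)
  exact inv_mul_le_one_of_le₀ h (Nat.cast_nonneg N)

variable {ρ : Γ →* Equiv.Perm (Fin N)} {T : Finset Γ} {K : Matrix (Fin N) (Fin N) ℂ}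

theorem norm_sharedCoeff_le (hK : ∀ x y, ‖K x y‖ ≤ 1) (t : Γ) (x : Fin N) :
    ‖sharedCoeff ρ T K t x‖ ≤ 1 := by
  rw [sharedCoeff, norm_div, Complex.norm_natCast]
  rcases Nat.eq_zero_or_pos (T.filter fun s => ρ s x = ρ t x).card with h | h
  · simp [h]
  · exact div_le_one_of_le₀ ((hK _ _).trans (by exact_mod_cast h)) (Nat.cast_nonneg _)

theorem norm_centeredCoeff_le (hK : ∀ x y, ‖K x y‖ ≤ 1) (t : Γ) (x : Fin N) :
    ‖centeredCoeff ρ T K t x‖ ≤ 2 := by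
  have h1 := norm_sharedCoeff_le (ρ := ρ) (T := T) hK t x
  have h2 : ‖average (localCoeff ρ K t)‖ ≤ 1 := norm_average_le fun x => hK _ _
  exact (norm_sub_le _ _).trans (by linarith)

variable (ρ T) in
/-- The number of pairs of distinct elements of `T`, with a vertex at which they agree. -/
def coincidenceCount : ℕ := by
  classical exact ∑ q ∈ T.offDiag, fixCount ρ (q.1⁻¹ * q.2)

/-- Sharing alters a coefficient only at a vertex where another `s ∈ T` agrees with `t`, which is a
fixed point of `s⁻¹t`. -/
theorem card_filter_sharedCoeff_ne_le {t : Γ} (ht : t ∈ T) :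
    (Finset.univ.filter fun x => sharedCoeff ρ T K t x ≠ localCoeff ρ K t x).card
      ≤ coincidenceCount ρ T := by
  classical
  have hsub : (Finset.univ.filter fun x => sharedCoeff ρ T K t x ≠ localCoeff ρ K t x) ⊆
      T.offDiag.biUnion fun q => Finset.univ.filter fun x => ρ (q.1⁻¹ * q.2) x = x := by
    intro x hx
    by_contra hcon
    refine (Finset.mem_filter.mp hx).2 ?_
    have h1 : (T.filter fun s => ρ s x = ρ t x) = {t} := by
      ext s
      rw [Finset.mem_filter, Finset.mem_singleton]
      refine ⟨fun hs => ?_, fun hs => by rw [hs]; exact ⟨ht, rfl⟩⟩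
      by_contra hne
      refine hcon (Finset.mem_biUnion.mpr ⟨(s, t), Finset.mem_offDiag.mpr
        ⟨hs.1, ht, hne⟩, ?_⟩)
      simp [← hs.2]
    rw [sharedCoeff, h1]
    simp
  refine (Finset.card_le_card hsub).trans (Finset.card_biUnion_le.trans (le_of_eq ?_))
  unfold coincidenceCount fixCount
  congr!

/-- The sum of `conj (c x) * c (g.x)` over the vertices. -/
def correlation (ρ : Γ →* Equiv.Perm (Fin N)) (c : Fin N → ℂ) (g : Γ) : ℂ :=
  ∑ x, conj (c x) * c (ρ g x)

theorem norm_correlation_le (hK : ∀ x y, ‖K x y‖ ≤ 1) (t g : Γ) :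
    ‖correlation ρ (centeredCoeff ρ T K t) g‖ ≤ 4 * N := by
  have h : ∀ x ∈ Finset.univ, ‖conj (centeredCoeff ρ T K t x) * centeredCoeff ρ T K t (ρ g x)‖
      ≤ 4 := fun x _ => by
    rw [norm_mul, RCLike.norm_conj]
    have := norm_centeredCoeff_le (ρ := ρ) (T := T) hK t x
    have := norm_centeredCoeff_le (ρ := ρ) (T := T) hK t (ρ g x)
    nlinarith [norm_nonneg (centeredCoeff ρ T K t x)]
  exact (norm_sum_le_of_le _ h).trans (by simp [mul_comm])

/-- The hypothesis concerns the unshared coefficients. Replacing them by the shared ones changes a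
summand only if `x` or `g.x` is an exceptional vertex, by at most `4 + 4` since both functions are
bounded by `2`; each of the two cases occurs once per exceptional vertex. -/
theorem norm_correlation_centeredCoeff_le (hK : ∀ x y, ‖K x y‖ ≤ 1) {t : Γ} (ht : t ∈ T)
    (g : Γ) :
    ‖correlation ρ (centeredCoeff ρ T K t) g‖
      ≤ N * ‖covariance ρ (localCoeff ρ K t) g‖ + 16 * coincidenceCount ρ T := by
  classical
  set c := centeredCoeff ρ T K t with hc
  set a := fun x => localCoeff ρ K t x - average (localCoeff ρ K t) with ha
  set B := Finset.univ.filter fun x => sharedCoeff ρ T K t x ≠ localCoeff ρ K t x with hB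
  have hcov : ‖correlation ρ a g‖ ≤ N * ‖covariance ρ (localCoeff ρ K t) g‖ := by
    rcases Nat.eq_zero_or_pos N with h | h
    · subst h
      simp [correlation]
    · rw [covariance, norm_mul, norm_inv, Complex.norm_natCast, mul_inv_cancel_left₀]
      · rfl
      · exact_mod_cast h.ne'
  have hc2 : ∀ x, ‖c x‖ ≤ 2 := norm_centeredCoeff_le hK t
  have ha2 : ∀ x, ‖a x‖ ≤ 2 := fun x => by
    have h1 : ‖localCoeff ρ K t x‖ ≤ 1 := hK _ _
    have h2 : ‖average (localCoeff ρ K t)‖ ≤ 1 := norm_average_le fun x => hK _ _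
    exact (norm_sub_le _ _).trans (by linarith)
  have hca : ∀ x, x ∉ B → c x = a x := fun x hx => by
    have : sharedCoeff ρ T K t x = localCoeff ρ K t x := by
      by_contra hne
      exact hx (Finset.mem_filter.mpr ⟨Finset.mem_univ _, hne⟩)
    rw [hc, ha, centeredCoeff, this]
  have hterm : ∀ x ∈ Finset.univ, ‖conj (c x) * c (ρ g x) - conj (a x) * a (ρ g x)‖
      ≤ (if x ∈ B then 8 else 0) + (if ρ g x ∈ B then 8 else 0 : ℝ) := fun x _ => by
    have hb : ‖conj (c x) * c (ρ g x) - conj (a x) * a (ρ g x)‖ ≤ 8 := by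
      refine (norm_sub_le _ _).trans ?_
      rw [norm_mul, norm_mul, RCLike.norm_conj, RCLike.norm_conj]
      nlinarith [norm_nonneg (c x), norm_nonneg (a x), hc2 x, ha2 x, hc2 (ρ g x), ha2 (ρ g x)]
    by_cases h1 : x ∈ B
    · rw [if_pos h1]
      refine hb.trans ?_
      split_ifs <;> norm_num
    · by_cases h2 : ρ g x ∈ B
      · rw [if_pos h2, if_neg h1, zero_add]
        exact hb
      · rw [hca x h1, hca _ h2]
        simp [h1, h2]
  have hsum : ‖correlation ρ c g - correlation ρ a g‖ ≤ 16 * (B.card : ℝ) := by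
    rw [correlation, correlation, ← Finset.sum_sub_distrib]
    refine (norm_sum_le_of_le _ hterm).trans (le_of_eq ?_)
    rw [Finset.sum_add_distrib,
      Equiv.sum_comp (ρ g) (fun x => if x ∈ B then (8 : ℝ) else 0)]
    simp
    ring
  have hBc : (B.card : ℝ) ≤ coincidenceCount ρ T := by
    exact_mod_cast card_filter_sharedCoeff_ne_le (K := K) ht
  have := norm_le_norm_add_norm_sub' (correlation ρ c g) (correlation ρ a g)
  linarith

end LocalMatrices

/-! ### Expansion of the trace over pairs of group elements -/

section TraceExpansion

variable {Γ : Type*} [Group Γ] {N : ℕ}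

theorem trace_localTerm (ρ : Γ →* Equiv.Perm (Fin N)) (t g h : Γ) (c : Fin N → ℂ) :
    ((permMatrix ρ t * Matrix.diagonal c).conjTranspose * permMatrix ρ h *
      (permMatrix ρ t * Matrix.diagonal c) * permMatrix ρ g).trace
      = ∑ x, if ρ (t⁻¹ * h * t * g) x = x then conj (c x) * c (ρ g x) else 0 := by
  have h1 : (permMatrix ρ t * Matrix.diagonal c).conjTranspose * permMatrix ρ h *
      (permMatrix ρ t * Matrix.diagonal c) * permMatrix ρ g
      = Matrix.diagonal (star c) *
        (permMatrix ρ (t⁻¹ * h * t) * (Matrix.diagonal c * permMatrix ρ g)) := by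
    rw [Matrix.conjTranspose_mul, conjTranspose_permMatrix, Matrix.diagonal_conjTranspose,
      permMatrix_mul, permMatrix_mul]
    simp only [mul_assoc]
  rw [h1, Matrix.trace]
  refine Finset.sum_congr rfl fun x _ => ?_
  rw [Matrix.diag_apply, Matrix.diagonal_mul, Matrix.mul_apply]
  simp only [Matrix.diagonal_mul, permMatrix, Matrix.of_apply, mul_ite, mul_one, mul_zero]
  rw [Finset.sum_ite_eq' Finset.univ (ρ g x)]
  have h2 : ρ (t⁻¹ * h * t * g) x = x ↔ x = ρ (t⁻¹ * h * t) (ρ g x) := by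
    rw [map_mul ρ _ g, Equiv.Perm.mul_apply, eq_comm]
  by_cases h3 : x = ρ (t⁻¹ * h * t) (ρ g x)
  · rw [if_pos (h2.mpr h3), ← h3]
    simp
  · rw [if_neg (fun h => h3 (h2.mp h)), if_neg h3]
    simp

theorem norm_trace_localTerm_le (ρ : Γ →* Equiv.Perm (Fin N)) (t g h : Γ) {c : Fin N → ℂ}
    (hc : ∀ x, ‖c x‖ ≤ 2) :
    ‖((permMatrix ρ t * Matrix.diagonal c).conjTranspose * permMatrix ρ h *
      (permMatrix ρ t * Matrix.diagonal c) * permMatrix ρ g).trace‖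
      ≤ 4 * fixCount ρ (t⁻¹ * h * t * g) := by
  rw [trace_localTerm]
  have hb : ∀ x ∈ Finset.univ,
      ‖if ρ (t⁻¹ * h * t * g) x = x then conj (c x) * c (ρ g x) else 0‖
      ≤ if ρ (t⁻¹ * h * t * g) x = x then (4 : ℝ) else 0 := fun x _ => by
    split_ifs
    · rw [norm_mul, RCLike.norm_conj]
      nlinarith [norm_nonneg (c x), hc x, hc (ρ g x)]
    · simp
  refine (norm_sum_le_of_le _ hb).trans (le_of_eq ?_)
  rw [← Finset.sum_filter, Finset.sum_const, nsmul_eq_mul, mul_comm]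
  rfl

theorem trace_localTerm_of_eq_one (ρ : Γ →* Equiv.Perm (Fin N)) {t g h : Γ}
    (hgh : t⁻¹ * h * t * g = 1) (c : Fin N → ℂ) :
    ((permMatrix ρ t * Matrix.diagonal c).conjTranspose * permMatrix ρ h *
      (permMatrix ρ t * Matrix.diagonal c) * permMatrix ρ g).trace = correlation ρ c g := by
  rw [trace_localTerm, hgh]
  simp [correlation]

open Classical in
/-- The contribution of the pairs of group elements whose product is not trivial. -/
def offDiagonalError (ρ : Γ →* Equiv.Perm (Fin N)) (t : Γ) (v w : MonoidAlgebra ℂ Γ) : ℝ :=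
  ∑ g ∈ v.coeff.support, ∑ h ∈ w.coeff.support, ‖v.coeff g‖ * (‖w.coeff h‖ *
    if t⁻¹ * h * t * g = 1 then 0 else 4 * (fixCount ρ (t⁻¹ * h * t * g) : ℝ))

/-- For given `g`, the only `h` with `t⁻¹htg = 1` is `tg⁻¹t⁻¹`; these pairs give the main sum. Every
other pair is bounded by fixed points of a nontrivial element. -/
theorem norm_trace_le (ρ : Γ →* Equiv.Perm (Fin N)) (t : Γ) {c : Fin N → ℂ}
    (hc : ∀ x, ‖c x‖ ≤ 2) (v w : MonoidAlgebra ℂ Γ) :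
    ‖((permMatrix ρ t * Matrix.diagonal c).conjTranspose * permRep ρ w *
      (permMatrix ρ t * Matrix.diagonal c) * permRep ρ v).trace‖
      ≤ ∑ g ∈ v.coeff.support, ‖v.coeff g‖ * (‖w.coeff (t * g⁻¹ * t⁻¹)‖ * ‖correlation ρ c g‖)
        + offDiagonalError ρ t v w := by
  classical
  have hexp : ((permMatrix ρ t * Matrix.diagonal c).conjTranspose * permRep ρ w *
      (permMatrix ρ t * Matrix.diagonal c) * permRep ρ v).trace
      = ∑ g ∈ v.coeff.support, ∑ h ∈ w.coeff.support, v.coeff g * (w.coeff h *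
        ((permMatrix ρ t * Matrix.diagonal c).conjTranspose * permMatrix ρ h *
          (permMatrix ρ t * Matrix.diagonal c) * permMatrix ρ g).trace) := by
    rw [permRep_apply, permRep_apply]
    simp only [Finset.mul_sum, Finset.sum_mul, Matrix.trace_sum, mul_smul_comm, smul_mul_assoc,
      Matrix.trace_smul, smul_eq_mul]
  rw [hexp, offDiagonalError, ← Finset.sum_add_distrib]
  refine norm_sum_le_of_le _ fun g _ => ?_
  have hterm : ∀ h ∈ w.coeff.support, ‖v.coeff g * (w.coeff h *
        ((permMatrix ρ t * Matrix.diagonal c).conjTranspose * permMatrix ρ h *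
          (permMatrix ρ t * Matrix.diagonal c) * permMatrix ρ g).trace)‖
      ≤ (if h = t * g⁻¹ * t⁻¹ then ‖v.coeff g‖ * (‖w.coeff h‖ * ‖correlation ρ c g‖) else 0) +
        ‖v.coeff g‖ * (‖w.coeff h‖ *
          if t⁻¹ * h * t * g = 1 then 0 else 4 * (fixCount ρ (t⁻¹ * h * t * g) : ℝ)) := by
    intro h _
    have hiff : t⁻¹ * h * t * g = 1 ↔ h = t * g⁻¹ * t⁻¹ := by
      constructor
      · intro h1
        rw [eq_inv_of_mul_eq_one_left h1 |>.symm]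
        group
      · rintro rfl
        group
    rw [norm_mul, norm_mul]
    by_cases h1 : t⁻¹ * h * t * g = 1
    · rw [trace_localTerm_of_eq_one ρ h1, if_pos h1, if_pos (hiff.mp h1)]
      simp
    · rw [if_neg h1, if_neg (fun h2 => h1 (hiff.mpr h2)), zero_add]
      gcongr
      exact norm_trace_localTerm_le ρ t g h hc
  refine (norm_sum_le_of_le _ hterm).trans ?_
  rw [Finset.sum_add_distrib]
  gcongr
  rw [Finset.sum_ite_eq']
  split_ifs
  · exact le_rfl
  · positivity

end TraceExpansion

/-! ### Limits in `N` and asymptotic decorrelation -/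

section Asymptotics

variable {Γ : Type*} [Group Γ] {N : ℕ → ℕ} {ρ : (n : ℕ) → Γ →* Equiv.Perm (Fin (N n))}

theorem ConvergesInDistribution.tendsto_fixCount (hρ : ConvergesInDistribution ρ) {g : Γ}
    (hg : g ≠ 1) : Tendsto (fun n => (fixCount (ρ n) g : ℝ) / N n) atTop (𝓝 0) := by
  have h := (hρ g hg).norm
  simp only [trace_permMatrix, norm_mul, norm_inv, Complex.norm_natCast, norm_zero] at h
  exact h.congr fun n => by rw [div_eq_inv_mul]

theorem ConvergesInDistribution.tendsto_coincidenceCount (hρ : ConvergesInDistribution ρ)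
    (T : Finset Γ) : Tendsto (fun n => (coincidenceCount (ρ n) T : ℝ) / N n) atTop (𝓝 0) := by
  classical
  simp only [coincidenceCount, Nat.cast_sum, Finset.sum_div]
  rw [← Finset.sum_const_zero (s := T.offDiag)]
  refine tendsto_finsetSum _ fun q hq => hρ.tendsto_fixCount fun h => ?_
  exact (Finset.mem_offDiag.mp (by convert hq)).2.2 (inv_mul_eq_one.mp h)

theorem ConvergesInDistribution.tendsto_offDiagonalError (hρ : ConvergesInDistribution ρ)
    (t : Γ) (v w : MonoidAlgebra ℂ Γ) :
    Tendsto (fun n => offDiagonalError (ρ n) t v w / N n) atTop (𝓝 0) := by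
  classical
  simp only [offDiagonalError, Finset.sum_div]
  rw [← Finset.sum_const_zero (s := v.coeff.support)]
  refine tendsto_finsetSum _ fun g _ => ?_
  rw [← Finset.sum_const_zero (s := w.coeff.support)]
  refine tendsto_finsetSum _ fun h _ => ?_
  by_cases h1 : t⁻¹ * h * t * g = 1
  · simp [h1]
  · simp only [h1, if_false, mul_div_assoc]
    simpa using (((hρ.tendsto_fixCount h1).const_mul 4).const_mul _).const_mul _

theorem ConvergesInDistribution.tendsto_trace_permRep (hN : Tendsto N atTop atTop)
    (hρ : ConvergesInDistribution ρ) (w : MonoidAlgebra ℂ Γ) :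
    Tendsto (fun n => (permRep (ρ n) w).trace / (N n : ℂ)) atTop (𝓝 (w.coeff 1)) := by
  classical
  have h1 : w.coeff 1 = ∑ g ∈ w.coeff.support, w.coeff g * if g = 1 then 1 else 0 := by
    simp +contextual [eq_comm]
  rw [h1]
  simp only [permRep_apply, Matrix.trace_sum, Matrix.trace_smul, Finset.sum_div, smul_eq_mul,
    mul_div_assoc]
  refine tendsto_finsetSum _ fun g _ => Tendsto.const_mul _ ?_
  by_cases hg : g = 1
  · rw [if_pos hg, hg]
    refine tendsto_const_nhds.congr' ?_
    filter_upwards [hN.eventually_gt_atTop 0] with n hn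
    have hn' : (N n : ℂ) ≠ 0 := by exact_mod_cast hn.ne'
    rw [trace_permMatrix, fixCount]
    simp [hn']
  · rw [if_neg hg]
    exact (hρ g hg).congr fun n => by rw [div_eq_inv_mul]

/-- On `F` the trivial bounds `b²` on the weights and `4N` on the correlation suffice. Off `F` the
correlation is at most `2εN`, and the weights are summed by the arithmetic-geometric inequality, `g
↦ tg⁻¹t⁻¹` being injective. The last `ε` pays for the off-diagonal pairs. -/
theorem eventually_norm_trace_le (hN : Tendsto N atTop atTop)
    (hρ : ConvergesInDistribution ρ) {T : Finset Γ}
    {K : (n : ℕ) → Matrix (Fin (N n)) (Fin (N n)) ℂ} (hK : ∀ n x y, ‖K n x y‖ ≤ 1)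
    {t : Γ} (ht : t ∈ T) {F : Finset Γ} {ε : ℝ} (hε : 0 < ε)
    (hF : ∀ g ∉ F, limsupCovariance ρ (fun n => localCoeff (ρ n) (K n) t) g < ENNReal.ofReal ε)
    {v w : MonoidAlgebra ℂ Γ} {b L : ℝ} (hb : 0 ≤ b) (hv : ∀ g, ‖v.coeff g‖ ≤ b)
    (hw : ∀ g, ‖w.coeff g‖ ≤ b) (hvL : ∀ s : Finset Γ, ∑ g ∈ s, ‖v.coeff g‖ ^ 2 ≤ L)
    (hwL : ∀ s : Finset Γ, ∑ g ∈ s, ‖w.coeff g‖ ^ 2 ≤ L) :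
    ∀ᶠ n in atTop,
      ‖((permMatrix (ρ n) t * Matrix.diagonal (centeredCoeff (ρ n) T (K n) t)).conjTranspose *
        permRep (ρ n) w *
        (permMatrix (ρ n) t * Matrix.diagonal (centeredCoeff (ρ n) T (K n) t)) *
        permRep (ρ n) v).trace‖ ≤ N n * (4 * b ^ 2 * F.card + 2 * ε * L + ε) := by
  classical
  have hcov : ∀ᶠ n in atTop, ∀ g ∈ v.coeff.support, g ∉ F →
      ‖covariance (ρ n) (localCoeff (ρ n) (K n) t) g‖ ≤ ε := by
    rw [eventually_all_finset]
    intro g _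
    by_cases hg : g ∈ F
    · exact Eventually.of_forall fun n h => absurd hg h
    · filter_upwards [eventually_lt_of_limsup_lt (hF g hg)] with n hn _
      rw [← ofReal_norm] at hn
      exact (ENNReal.ofReal_lt_ofReal_iff hε).mp hn |>.le
  -- The factor `1/16` offsets the `16` in `norm_correlation_centeredCoeff_le`.
  have hco : ∀ᶠ n in atTop, (coincidenceCount (ρ n) T : ℝ) / N n < ε / 16 :=
    (hρ.tendsto_coincidenceCount T).eventually_lt_const (by positivity)
  have hoff : ∀ᶠ n in atTop, offDiagonalError (ρ n) t v w / N n < ε :=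
    (hρ.tendsto_offDiagonalError t v w).eventually_lt_const hε
  filter_upwards [hcov, hco, hoff, hN.eventually_gt_atTop 0] with n h1 h2 h3 hn
  have hn' : (0 : ℝ) < N n := by exact_mod_cast hn
  rw [div_lt_iff₀ hn'] at h2 h3
  refine (norm_trace_le (ρ n) t (norm_centeredCoeff_le (hK n) t) v w).trans ?_
  have hterm : ∀ g ∈ v.coeff.support, ‖v.coeff g‖ * (‖w.coeff (t * g⁻¹ * t⁻¹)‖ *
      ‖correlation (ρ n) (centeredCoeff (ρ n) T (K n) t) g‖)
      ≤ (if g ∈ F then N n * (4 * b ^ 2) else 0) +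
        N n * ε * (‖v.coeff g‖ ^ 2 + ‖w.coeff (t * g⁻¹ * t⁻¹)‖ ^ 2) := by
    intro g hg
    have hr : 0 ≤ N n * ε * (‖v.coeff g‖ ^ 2 + ‖w.coeff (t * g⁻¹ * t⁻¹)‖ ^ 2) := by positivity
    rw [← mul_assoc]
    by_cases hgF : g ∈ F
    · rw [if_pos hgF]
      have h4 : ‖v.coeff g‖ * ‖w.coeff (t * g⁻¹ * t⁻¹)‖ ≤ b * b :=
        mul_le_mul (hv g) (hw _) (norm_nonneg _) hb
      have h5 := norm_correlation_le (ρ := ρ n) (T := T) (hK n) t g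
      have := mul_le_mul h4 h5 (norm_nonneg _) (by positivity)
      nlinarith
    · rw [if_neg hgF, zero_add]
      have h4 : ‖v.coeff g‖ * ‖w.coeff (t * g⁻¹ * t⁻¹)‖
          ≤ (‖v.coeff g‖ ^ 2 + ‖w.coeff (t * g⁻¹ * t⁻¹)‖ ^ 2) / 2 := by
        nlinarith [sq_nonneg (‖v.coeff g‖ - ‖w.coeff (t * g⁻¹ * t⁻¹)‖)]
      have h5 := norm_correlation_centeredCoeff_le (ρ := ρ n) (hK n) ht g
      have h6 : ‖correlation (ρ n) (centeredCoeff (ρ n) T (K n) t) g‖ ≤ N n * (2 * ε) := by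
        have := mul_le_mul_of_nonneg_left (h1 g hg hgF) hn'.le
        linarith
      calc _ ≤ (‖v.coeff g‖ ^ 2 + ‖w.coeff (t * g⁻¹ * t⁻¹)‖ ^ 2) / 2 * (N n * (2 * ε)) :=
            mul_le_mul h4 h6 (norm_nonneg _) (by positivity)
        _ = _ := by ring
  have hFsum : ∑ g ∈ v.coeff.support, (if g ∈ F then N n * (4 * b ^ 2) else 0 : ℝ)
      ≤ F.card * (N n * (4 * b ^ 2)) := by
    rw [← Finset.sum_filter, Finset.sum_const, nsmul_eq_mul]
    gcongr
    intro g hg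
    exact (Finset.mem_filter.mp hg).2
  have hwsum : ∑ g ∈ v.coeff.support, ‖w.coeff (t * g⁻¹ * t⁻¹)‖ ^ 2 ≤ L := by
    have hinj : Function.Injective fun g : Γ => t * g⁻¹ * t⁻¹ := fun g h hgh => by simpa using hgh
    rw [← Finset.sum_image (f := fun h => ‖w.coeff h‖ ^ 2) fun g _ h _ hgh => hinj hgh]
    exact hwL _
  have hsum := Finset.sum_le_sum hterm
  rw [Finset.sum_add_distrib, ← Finset.mul_sum, Finset.sum_add_distrib] at hsum
  have hL : N n * ε * (∑ g ∈ v.coeff.support, ‖v.coeff g‖ ^ 2 +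
      ∑ g ∈ v.coeff.support, ‖w.coeff (t * g⁻¹ * t⁻¹)‖ ^ 2) ≤ N n * ε * (L + L) := by
    gcongr
    exact hvL _
  linarith

/-- Balls for the word length are finite, as images of the words of bounded length in a finite
alphabet. Hence decay as `|g| → ∞` holds off a finite set of group elements. -/
theorem cofinite_le_comap_wordLength {S : Finset Γ}
    (hS : Subgroup.closure (S : Set Γ) = ⊤) : cofinite ≤ comap (wordLength S) atTop := by
  classical
  rw [← tendsto_iff_comap, tendsto_atTop]
  intro r
  rw [eventually_cofinite]
  have hfin : Finite {s : Γ // s ∈ S ∨ s⁻¹ ∈ S} := by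
    refine Set.Finite.subset (S.finite_toSet.union (S.image (·⁻¹)).finite_toSet) fun s hs => ?_
    rcases hs with h | h
    · exact Or.inl h
    · exact Or.inr (by simpa using h)
  refine ((List.finite_length_lt {s : Γ // s ∈ S ∨ s⁻¹ ∈ S} r).image
    fun l => (l.map Subtype.val).prod).subset fun g hg => ?_
  have hg' : wordLength S g < r := not_le.mp hg
  obtain ⟨l₀, hl₀, hprod₀⟩ := Submonoid.exists_list_of_mem_closure
    (show g ∈ Submonoid.closure ((S : Set Γ) ∪ (S : Set Γ)⁻¹) by
      rw [← Subgroup.closure_toSubmonoid, hS]; trivial)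
  -- Since `S` generates, the infimum is over a nonempty set and is attained; otherwise `sInf ∅ = 0`
  -- would put unreachable elements in every ball of positive radius.
  have hne : {n : ℕ | ∃ l : List Γ, (∀ s ∈ l, s ∈ S ∨ s⁻¹ ∈ S) ∧ l.prod = g ∧
      l.length = n}.Nonempty := ⟨_, l₀, hl₀, hprod₀, rfl⟩
  obtain ⟨l, hl, hprod, hlen⟩ := Nat.sInf_mem hne
  refine ⟨l.attach.map fun s => ⟨s.1, hl s.1 s.2⟩, ?_, ?_⟩
  · simpa [hlen] using (show sInf _ < r from hg')
  · simpa [List.map_map, Function.comp_def] using hprod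

theorem exists_finset_limsupCovariance_lt {S T : Finset Γ}
    (hS : Subgroup.closure (S : Set Γ) = ⊤)
    {K : (n : ℕ) → Matrix (Fin (N n)) (Fin (N n)) ℂ}
    (hunc : IsAsympUncorrelatedLocal S T ρ K) {ε : ℝ} (hε : 0 < ε) :
    ∃ F : Finset Γ, ∀ t ∈ T, ∀ g ∉ F,
      limsupCovariance ρ (fun n => localCoeff (ρ n) (K n) t) g < ENNReal.ofReal ε := by
  have h : ∀ᶠ g in cofinite, ∀ t ∈ T,
      limsupCovariance ρ (fun n => localCoeff (ρ n) (K n) t) g < ENNReal.ofReal ε := by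
    rw [eventually_all_finset]
    intro t ht
    exact ((hunc t ht).mono_left (cofinite_le_comap_wordLength hS)).eventually_lt_const
      (by simpa using hε)
  rw [eventually_cofinite] at h
  refine ⟨h.toFinset, fun t ht g hg => ?_⟩
  rw [Set.Finite.mem_toFinset, Set.mem_ofPred_eq, not_not] at hg
  exact hg t ht

end Asymptotics

/-! ### Eigenvalue counts and window sums -/

section Windows

open Polynomial

variable {Γ : Type*} [Group Γ] {N : ℕ → ℕ} {ρ : (n : ℕ) → Γ →* Equiv.Perm (Fin (N n))}
  {p : MonoidAlgebra ℂ Γ}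
  {φ : (n : ℕ) → OrthonormalBasis (Fin (N n)) ℂ (EuclideanSpace ℂ (Fin (N n)))}
  {ev : (n : ℕ) → Fin (N n) → ℝ}

/-- The sum of the squared matrix elements of `K - M` between two spectral windows. -/
def windowSum {N : ℕ} (φ : OrthonormalBasis (Fin N) ℂ (EuclideanSpace ℂ (Fin N)))
    (ev : Fin N → ℝ) (K M : Matrix (Fin N) (Fin N) ℂ) (I J : Set ℝ) : ℝ :=
  ∑ α ∈ indexSet ev I, ∑ β ∈ indexSet ev J, ‖matrixElement φ K β α - matrixElement φ M β α‖ ^ 2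

theorem mem_indexSet {N : ℕ} {ev : Fin N → ℝ} {J : Set ℝ} {α : Fin N} :
    α ∈ indexSet ev J ↔ ev α ∈ J := by
  simp [indexSet]

/-- The count is at least `Tr q(P_N)` for a minorant `q`, and the normalised trace converges to the
coefficient of `q(p)` at `e`. Halving the constant leaves room for the limit. -/
theorem eventually_le_card_indexSet (hN : Tendsto N atTop atTop)
    (hρ : ConvergesInDistribution ρ) (hp : IsSelfAdjointElement p)
    (hφ : ∀ n, IsEigenbasis (schreierOp (ρ n) p) (φ n) (ev n)) {C₀ : ℝ} (hC₀ : 1 ≤ C₀) {E : ℝ}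
    (hE : ∀ η : ℝ, 0 < η → η ≤ 1 →
      C₀⁻¹ ≤ imResolventAtOne p ((E : ℂ) + (η : ℂ) * Complex.I) ∧
      imResolventAtOne p ((E : ℂ) + (η : ℂ) * Complex.I) ≤ C₀)
    {η : ℝ} (hη : 0 < η) (hη1 : η ≤ 1) :
    ∀ᶠ n in atTop, N n * (η / (32 * C₀ ^ 3))
      ≤ ((indexSet (ev n) (Set.Icc (E - η) (E + η))).card : ℝ) := by
  obtain ⟨q, hq1, hq0, hq⟩ := exists_minorant_polynomial hp hC₀ hE hη hη1
  have hlim := (Complex.continuous_re.tendsto _).comp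
    (hρ.tendsto_trace_permRep hN (aeval p q))
  have hlt : η / (32 * C₀ ^ 3) < ((aeval p q).coeff 1).re := by
    refine lt_of_lt_of_le ?_ hq
    gcongr
    norm_num
  filter_upwards [hlim.eventually_const_lt hlt, hN.eventually_gt_atTop 0] with n hn hn0
  have hn' : (0 : ℝ) < N n := by exact_mod_cast hn0
  rw [Function.comp_apply, permRep_aeval, ← (hφ n).sum_eval, ← Complex.ofReal_sum,
    ← Complex.ofReal_natCast, ← Complex.ofReal_div, Complex.ofReal_re, lt_div_iff₀ hn'] at hn
  rw [mul_comm]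
  refine hn.le.trans ?_
  have hterm : ∀ α ∈ Finset.univ, q.eval (ev n α)
      ≤ if ev n α ∈ Set.Icc (E - η) (E + η) then (1 : ℝ) else 0 := fun α _ => by
    split_ifs with h
    · exact hq1 _ ((hφ n).mem_Icc α)
    · exact hq0 _ ((hφ n).mem_Icc α) h
  refine (Finset.sum_le_sum hterm).trans (le_of_eq ?_)
  rw [← Finset.sum_filter, Finset.sum_const, nsmul_eq_mul, mul_one, indexSet]
  congr!

theorem norm_matrixElement_sub_sq_le {N : ℕ} {ρ : Γ →* Equiv.Perm (Fin N)} {T : Finset Γ}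
    {K : Matrix (Fin N) (Fin N) ℂ} (hK : IsLocal ρ T K)
    (φ : OrthonormalBasis (Fin N) ℂ (EuclideanSpace ℂ (Fin N))) (β α : Fin N) :
    ‖matrixElement φ K β α - matrixElement φ (averageOp ρ T K) β α‖ ^ 2
      ≤ T.card * ∑ t ∈ T, ‖matrixElement φ
        (permMatrix ρ t * Matrix.diagonal (centeredCoeff ρ T K t)) β α‖ ^ 2 := by
  have h : matrixElement φ K β α - matrixElement φ (averageOp ρ T K) β α
      = ∑ t ∈ T, matrixElement φ
        (permMatrix ρ t * Matrix.diagonal (centeredCoeff ρ T K t)) β α := by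
    simp only [matrixElement]
    rw [← inner_sub_right, ← LinearMap.sub_apply, ← map_sub, hK.sub_averageOp, map_sum,
      LinearMap.sum_apply, inner_sum]
  rw [h]
  refine (pow_le_pow_left₀ (norm_nonneg _) (norm_sum_le _ _) 2).trans ?_
  exact sq_sum_le_card_mul_sum_sq

/-- The window sum is bounded by majorizing the indicators of the two windows by `2ηq` and `2ηr`. -/
theorem IsEigenbasis.windowSum_le {N : ℕ} {ρ : Γ →* Equiv.Perm (Fin N)} {T : Finset Γ}
    {K : Matrix (Fin N) (Fin N) ℂ} (hK : IsLocal ρ T K)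
    {φ : OrthonormalBasis (Fin N) ℂ (EuclideanSpace ℂ (Fin N))} {ev : Fin N → ℝ}
    (hφ : IsEigenbasis (schreierOp ρ p) φ ev) {I J : Set ℝ} {η : ℝ} (hη : 0 < η) {q r : ℝ[X]}
    (hq : ∀ x ∈ Set.Icc (-coeffNorm p) (coeffNorm p), 0 ≤ q.eval x)
    (hr : ∀ x ∈ Set.Icc (-coeffNorm p) (coeffNorm p), 0 ≤ r.eval x)
    (hqI : ∀ x ∈ Set.Icc (-coeffNorm p) (coeffNorm p), x ∈ I → 1 ≤ 2 * η * q.eval x)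
    (hrJ : ∀ x ∈ Set.Icc (-coeffNorm p) (coeffNorm p), x ∈ J → 1 ≤ 2 * η * r.eval x) :
    windowSum φ ev K (averageOp ρ T K) I J ≤ 4 * η ^ 2 * (T.card * ∑ t ∈ T,
      ‖((permMatrix ρ t * Matrix.diagonal (centeredCoeff ρ T K t)).conjTranspose *
        permRep ρ (aeval p r) *
        (permMatrix ρ t * Matrix.diagonal (centeredCoeff ρ T K t)) *
        permRep ρ (aeval p q)).trace‖) := by
  set B : Γ → Matrix (Fin N) (Fin N) ℂ := fun t =>
    permMatrix ρ t * Matrix.diagonal (centeredCoeff ρ T K t) with hB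
  have hspec := hφ.mem_Icc
  have hterm : ∀ α β, ev α ∈ I → ev β ∈ J →
      ‖matrixElement φ K β α - matrixElement φ (averageOp ρ T K) β α‖ ^ 2
      ≤ 4 * η ^ 2 * (T.card * ∑ t ∈ T,
        q.eval (ev α) * (r.eval (ev β) * ‖matrixElement φ (B t) β α‖ ^ 2)) := by
    intro α β hα hβ
    refine (norm_matrixElement_sub_sq_le hK φ β α).trans ?_
    have h1 : 1 ≤ 2 * η * q.eval (ev α) * (2 * η * r.eval (ev β)) :=
      one_le_mul_of_one_le_of_one_le (hqI _ (hspec α) hα) (hrJ _ (hspec β) hβ)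
    refine (le_mul_of_one_le_left (by positivity) h1).trans (le_of_eq ?_)
    simp only [← Finset.mul_sum]
    ring
  -- Nonnegativity on the whole spectrum allows the sums to be extended from the windows to all
  -- indices, where they become traces.
  have hpos : ∀ α β, 0 ≤ 4 * η ^ 2 * (T.card * ∑ t ∈ T,
        q.eval (ev α) * (r.eval (ev β) * ‖matrixElement φ (B t) β α‖ ^ 2)) := by
    intro α β
    have h1 := hq _ (hspec α)
    have h2 := hr _ (hspec β)
    positivity
  calc windowSum φ ev K (averageOp ρ T K) I J
      ≤ ∑ α ∈ indexSet ev I, ∑ β ∈ indexSet ev J, 4 * η ^ 2 * (T.card * ∑ t ∈ T,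
        q.eval (ev α) * (r.eval (ev β) * ‖matrixElement φ (B t) β α‖ ^ 2)) :=
        Finset.sum_le_sum fun α hα => Finset.sum_le_sum fun β hβ =>
          hterm α β (mem_indexSet.mp hα) (mem_indexSet.mp hβ)
    _ ≤ ∑ α, ∑ β, 4 * η ^ 2 * (T.card * ∑ t ∈ T,
        q.eval (ev α) * (r.eval (ev β) * ‖matrixElement φ (B t) β α‖ ^ 2)) := by
        refine (Finset.sum_le_sum fun α _ => Finset.sum_le_univ_sum_of_nonneg fun β =>
          hpos α β).trans ?_
        exact Finset.sum_le_univ_sum_of_nonneg fun α => Finset.sum_nonneg fun β _ => hpos α β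
    _ = 4 * η ^ 2 * (T.card * ∑ t ∈ T, ∑ α, ∑ β,
        q.eval (ev α) * (r.eval (ev β) * ‖matrixElement φ (B t) β α‖ ^ 2)) := by
        simp_rw [Finset.sum_comm (s := T), Finset.mul_sum]
    _ ≤ _ := by
        gcongr with t ht
        rw [permRep_aeval, permRep_aeval, ← hφ.sum_eval_mul_eval q r (B t), Complex.norm_real]
        exact le_abs_self _

/-- The prefactor `4η²` meets `O(|F|)` from the finite set and `O(ε/η)` from the `ℓ²` norms. One
factor `|T|` is from Cauchy–Schwarz, the other from summing over `t`. The resolvent bound is needed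
only at the window centres. -/
theorem eventually_windowSum_le (hN : Tendsto N atTop atTop)
    (hρ : ConvergesInDistribution ρ) (hp : IsSelfAdjointElement p)
    (hφ : ∀ n, IsEigenbasis (schreierOp (ρ n) p) (φ n) (ev n)) {T : Finset Γ}
    {K : (n : ℕ) → Matrix (Fin (N n)) (Fin (N n)) ℂ} (hloc : ∀ n, IsLocal (ρ n) T (K n))
    (hK : ∀ n x y, ‖K n x y‖ ≤ 1) {F : Finset Γ} {ε : ℝ} (hε : 0 < ε)
    (hF : ∀ t ∈ T, ∀ g ∉ F,
      limsupCovariance ρ (fun n => localCoeff (ρ n) (K n) t) g < ENNReal.ofReal ε)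
    {C₀ : ℝ} (hC₀ : 1 ≤ C₀) {E₁ E₂ η : ℝ} (hη : 0 < η) (hη1 : η ≤ 1)
    (hE₁ : imResolventAtOne p ((E₁ : ℂ) + (η : ℂ) * Complex.I) ≤ C₀)
    (hE₂ : imResolventAtOne p ((E₂ : ℂ) + (η : ℂ) * Complex.I) ≤ C₀) :
    ∀ᶠ n in atTop, windowSum (φ n) (ev n) (K n) (averageOp (ρ n) T (K n))
        (Set.Icc (E₁ - η) (E₁ + η)) (Set.Icc (E₂ - η) (E₂ + η))
      ≤ N n * (64 * C₀ ^ 2 * T.card ^ 2 * (η * (η * F.card + ε))) := by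
  obtain ⟨q, hq0, hq1, hqb, hqL⟩ := exists_majorant_polynomial hp hC₀ hη hη1 hE₁
  obtain ⟨r, hr0, hr1, hrb, hrL⟩ := exists_majorant_polynomial hp hC₀ hη hη1 hE₂
  have hall : ∀ᶠ n in atTop, ∀ t ∈ T,
      ‖((permMatrix (ρ n) t * Matrix.diagonal (centeredCoeff (ρ n) T (K n) t)).conjTranspose *
        permRep (ρ n) (aeval p r) *
        (permMatrix (ρ n) t * Matrix.diagonal (centeredCoeff (ρ n) T (K n) t)) *
        permRep (ρ n) (aeval p q)).trace‖
      ≤ N n * (4 * (2 * C₀) ^ 2 * F.card + 2 * ε * (4 * C₀ / η) + ε) := by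
    rw [eventually_all_finset]
    intro t ht
    exact eventually_norm_trace_le hN hρ hK ht hε (hF t ht) (by positivity) hqb hrb hqL hrL
  filter_upwards [hall] with n hn
  refine ((hφ n).windowSum_le (hloc n) hη hq0 hr0 hq1 hr1).trans ?_
  have hsum := Finset.sum_le_card_nsmul _ _ _ hn
  rw [nsmul_eq_mul] at hsum
  have h1 : 4 * η ^ 2 * (4 * (2 * C₀) ^ 2 * F.card + 2 * ε * (4 * C₀ / η) + ε)
      ≤ 64 * C₀ ^ 2 * (η * (η * F.card + ε)) := by
    have h2 : 4 * η ^ 2 * (4 * (2 * C₀) ^ 2 * F.card + 2 * ε * (4 * C₀ / η) + ε)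
        = 64 * C₀ ^ 2 * (η * (η * F.card)) + η * ε * (32 * C₀ + 4 * η) := by
      field_simp
      ring
    have h3 : 32 * C₀ + 4 * η ≤ 64 * C₀ ^ 2 := by nlinarith
    have h4 := mul_le_mul_of_nonneg_left h3 (mul_pos hη hε).le
    rw [h2]
    linarith
  calc _ ≤ 4 * η ^ 2 * (T.card * (T.card *
        (N n * (4 * (2 * C₀) ^ 2 * F.card + 2 * ε * (4 * C₀ / η) + ε)))) := by gcongr
    _ = N n * T.card ^ 2 *
        (4 * η ^ 2 * (4 * (2 * C₀) ^ 2 * F.card + 2 * ε * (4 * C₀ / η) + ε)) := by ring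
    _ ≤ N n * T.card ^ 2 * (64 * C₀ ^ 2 * (η * (η * F.card + ε))) := by gcongr
    _ = _ := by ring

/-- A diagonal term with eigenvalue in `J i` is one of the nonnegative terms of the double sum over
`J i × J i`. -/
theorem sum_diagonal_le_sum_windowSum {N : ℕ}
    (φ : OrthonormalBasis (Fin N) ℂ (EuclideanSpace ℂ (Fin N))) (ev : Fin N → ℝ)
    (K M : Matrix (Fin N) (Fin N) ℂ) {I : Set ℝ} {ι : Type*} (s : Finset ι) (J : ι → Set ℝ)
    (hI : I ⊆ ⋃ i ∈ s, J i) :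
    ∑ α ∈ indexSet ev I, ‖matrixElement φ K α α - matrixElement φ M α α‖ ^ 2
      ≤ ∑ i ∈ s, windowSum φ ev K M (J i) (J i) := by
  classical
  have h2 : ∀ α ∈ indexSet ev I, ‖matrixElement φ K α α - matrixElement φ M α α‖ ^ 2
      ≤ ∑ i ∈ s, if ev α ∈ J i then ‖matrixElement φ K α α - matrixElement φ M α α‖ ^ 2 else 0 := by
    intro α hα
    obtain ⟨i, hi, hαi⟩ := Set.mem_iUnion₂.mp (hI (mem_indexSet.mp hα))
    refine le_trans (le_of_eq (if_pos hαi).symm) (Finset.single_le_sum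
      (f := fun i => if ev α ∈ J i then ‖matrixElement φ K α α - matrixElement φ M α α‖ ^ 2 else 0)
      (fun _ _ => by positivity) hi)
  refine (Finset.sum_le_sum h2).trans ?_
  rw [Finset.sum_comm]
  refine Finset.sum_le_sum fun i _ => ?_
  rw [← Finset.sum_filter]
  refine (Finset.sum_le_sum_of_subset_of_nonneg (t := indexSet ev (J i)) (fun α hα =>
    mem_indexSet.mpr (Finset.mem_filter.mp hα).2) fun _ _ _ => by positivity).trans ?_
  exact Finset.sum_le_sum fun α hα =>
    Finset.single_le_sum (f := fun β => ‖matrixElement φ K β α - matrixElement φ M β α‖ ^ 2)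
      (fun _ _ => by positivity) hα

theorem Icc_subset_iUnion_windows {c d η : ℝ} {k : ℕ} (hη : 0 < η) (hk : k * η = d - c) :
    Set.Icc c d ⊆ ⋃ i ∈ Finset.range (k + 1),
      Set.Icc (c + i * η - η) (c + i * η + η) := by
  intro x hx
  have h0 : 0 ≤ (x - c) / η := div_nonneg (by linarith [hx.1]) hη.le
  have h1 := Nat.floor_le h0
  have h2 := Nat.lt_floor_add_one ((x - c) / η)
  rw [le_div_iff₀ hη] at h1
  rw [div_lt_iff₀ hη] at h2
  refine Set.mem_iUnion₂.mpr ⟨⌊(x - c) / η⌋₊, ?_, by constructor <;> linarith⟩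
  rw [Finset.mem_range, Nat.lt_add_one_iff]
  have h3 : (⌊(x - c) / η⌋₊ : ℝ) * η ≤ k * η := by linarith [hx.2]
  exact_mod_cast le_of_mul_le_mul_right h3 hη

end Windows

/-! ### Choice of parameters and the two conclusions -/

section Conclusion

variable {Γ : Type*} [Group Γ] {N : ℕ → ℕ} {ρ : (n : ℕ) → Γ →* Equiv.Perm (Fin (N n))}
  {p : MonoidAlgebra ℂ Γ}
  {φ : (n : ℕ) → OrthonormalBasis (Fin (N n)) ℂ (EuclideanSpace ℂ (Fin (N n)))}
  {ev : (n : ℕ) → Fin (N n) → ℝ} {S T : Finset Γ}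
  {K : (n : ℕ) → Matrix (Fin (N n)) (Fin (N n)) ℂ}

theorem smallScaleQuantumMixing_of_resolventBound (hS : Subgroup.closure (S : Set Γ) = ⊤)
    (hN : Tendsto N atTop atTop) (hρ : ConvergesInDistribution ρ) (hp : IsSelfAdjointElement p)
    {I : Set ℝ} (hI : ResolventBound p I)
    (hφ : ∀ n, IsEigenbasis (schreierOp (ρ n) p) (φ n) (ev n))
    (hloc : ∀ n, IsLocal (ρ n) T (K n)) (hK : ∀ n x y, ‖K n x y‖ ≤ 1)
    (hunc : IsAsympUncorrelatedLocal S T ρ K) : SmallScaleQuantumMixing T ρ φ ev K I := by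
  obtain ⟨C₀, hC₀, hb⟩ := hI
  intro E₁ hE₁ E₂ hE₂
  replace hE₁ := interior_subset hE₁
  replace hE₂ := interior_subset hE₂
  -- `D - 1` is the constant in the quotient of the window sum by the count; the added `1` keeps `D`
  -- positive when `T` is empty.
  obtain ⟨D, hD⟩ : ∃ D, D = 64 * C₀ ^ 2 * T.card ^ 2 * (32 * C₀ ^ 3) + 1 := ⟨_, rfl⟩
  have hD0 : 0 < D := by rw [hD]; positivity
  rw [ENNReal.tendsto_nhds_zero]
  intro e he
  rcases eq_or_ne e ⊤ with rfl | hetop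
  · exact Eventually.of_forall fun _ => le_top
  obtain ⟨δ, hδ, rfl⟩ : ∃ δ : ℝ, 0 < δ ∧ e = ENNReal.ofReal δ :=
    ⟨e.toReal, ENNReal.toReal_pos he.ne' hetop, (ENNReal.ofReal_toReal hetop).symm⟩
  obtain ⟨F, hF⟩ := exists_finset_limsupCovariance_lt hS hunc
    (show 0 < δ / (2 * D) by positivity)
  have hη0 : ∀ᶠ η : ℝ in 𝓝[>] 0, η < min 1 (δ / (2 * D * (F.card + 1))) :=
    nhdsWithin_le_nhds (eventually_lt_nhds (by positivity))
  filter_upwards [hη0, self_mem_nhdsWithin] with η hη hη0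
  replace hη0 : 0 < η := hη0
  have hη1 : η ≤ 1 := (hη.trans_le (min_le_left _ _)).le
  have hη2 : η * (2 * D * (F.card + 1)) ≤ δ :=
    (le_div_iff₀ (by positivity)).mp (hη.trans_le (min_le_right _ _)).le
  refine limsup_le_of_le (by isBoundedDefault) ?_
  filter_upwards [eventually_windowSum_le hN hρ hp hφ hloc hK (by positivity) hF hC₀ hη0 hη1
    (hb E₁ hE₁ η hη0 hη1).2 (hb E₂ hE₂ η hη0 hη1).2,
    eventually_le_card_indexSet hN hρ hp hφ hC₀ (hb E₁ hE₁) hη0 hη1,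
    hN.eventually_gt_atTop 0] with n h1 h2 hn
  have hn' : (0 : ℝ) < N n := by exact_mod_cast hn
  refine ENNReal.ofReal_le_ofReal ?_
  rw [mixedMoment, ← div_eq_inv_mul]
  have h3 : 0 < N n * (η / (32 * C₀ ^ 3)) := by positivity
  refine div_le_of_le_mul₀ (h3.le.trans h2) hδ.le (h1.trans ?_)
  have h4 : D * (η * F.card + δ / (2 * D)) ≤ δ := by
    have : D * (η * F.card + δ / (2 * D)) = η * (D * F.card) + δ / 2 := by field_simp
    nlinarith [mul_pos hη0 hD0]
  calc N n * (64 * C₀ ^ 2 * T.card ^ 2 * (η * (η * F.card + δ / (2 * D))))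
      = (D - 1) * (η * F.card + δ / (2 * D)) * (N n * (η / (32 * C₀ ^ 3))) := by
        rw [hD]; field_simp; ring
    _ ≤ δ * (N n * (η / (32 * C₀ ^ 3))) := by
        gcongr
        refine le_trans ?_ h4
        gcongr
        linarith
    _ ≤ _ := by gcongr

theorem quantumErgodicity_of_resolventBound (hS : Subgroup.closure (S : Set Γ) = ⊤)
    (hN : Tendsto N atTop atTop) (hρ : ConvergesInDistribution ρ) (hp : IsSelfAdjointElement p)
    {c d : ℝ} (hcd : c < d) (hI : ResolventBound p (Set.Icc c d))
    (hφ : ∀ n, IsEigenbasis (schreierOp (ρ n) p) (φ n) (ev n))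
    (hloc : ∀ n, IsLocal (ρ n) T (K n)) (hK : ∀ n x y, ‖K n x y‖ ≤ 1)
    (hunc : IsAsympUncorrelatedLocal S T ρ K) :
    QuantumErgodicity T ρ φ ev K (Set.Icc c d) := by
  obtain ⟨C₀, hC₀, hb⟩ := hI
  -- A fixed window about the midpoint, contained in `[c, d]`, bounds the number of eigenvalues in
  -- `I` below independently of `η`.
  obtain ⟨η₀, hη₀, hη₀1, hη₀d⟩ : ∃ η₀ : ℝ, 0 < η₀ ∧ η₀ ≤ 1 ∧ η₀ ≤ (d - c) / 2 :=
    ⟨min 1 ((d - c) / 2), lt_min one_pos (by linarith), min_le_left _ _, min_le_right _ _⟩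
  obtain ⟨D, hD⟩ : ∃ D, D = 2 * (d - c) * (64 * C₀ ^ 2 * T.card ^ 2 * (32 * C₀ ^ 3 / η₀)) + 1 :=
    ⟨_, rfl⟩
  have hdc : 0 < d - c := sub_pos.mpr hcd
  have hD0 : 0 < D := by rw [hD]; positivity
  refine tendsto_order.mpr ⟨fun e he => Eventually.of_forall fun n => he.trans_le ?_,
    fun δ hδ => ?_⟩
  · unfold diagonalMoment
    positivity
  obtain ⟨F, hF⟩ := exists_finset_limsupCovariance_lt hS hunc
    (show 0 < δ / (4 * D) by positivity)
  -- The first bound gives `η = (d - c)/k ≤ 1`, the second makes `Dη|F|` at most `δ/4`.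
  obtain ⟨k, hk⟩ := exists_nat_gt (max (d - c) ((d - c) * (4 * D * (F.card + 1)) / δ))
  have hk0 : (0 : ℝ) < k := hdc.trans ((le_max_left _ _).trans_lt hk)
  have hk1 : (1 : ℝ) ≤ k := by exact_mod_cast hk0
  obtain ⟨η, hη⟩ : ∃ η, η = (d - c) / k := ⟨_, rfl⟩
  have hη0 : 0 < η := by rw [hη]; positivity
  have hη1 : η ≤ 1 := by
    rw [hη, div_le_one hk0]
    exact ((le_max_left _ _).trans_lt hk).le
  have hkη : k * η = d - c := by rw [hη]; field_simp
  have hη2 : η * (4 * D * (F.card + 1)) ≤ δ := by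
    have := ((le_max_right _ _).trans_lt hk).le
    rw [div_le_iff₀ hδ] at this
    rw [hη, div_mul_eq_mul_div, div_le_iff₀ hk0]
    linarith
  have hcen : ∀ i ∈ Finset.range (k + 1), c + i * η ∈ Set.Icc c d := by
    intro i hi
    have h1 : (i : ℝ) ≤ k := by exact_mod_cast Nat.lt_add_one_iff.mp (Finset.mem_range.mp hi)
    have h2 := mul_le_mul_of_nonneg_right h1 hη0.le
    exact ⟨by linarith [mul_nonneg (Nat.cast_nonneg (α := ℝ) i) hη0.le], by linarith⟩
  have hwin : ∀ᶠ n in atTop, ∀ i ∈ Finset.range (k + 1),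
      windowSum (φ n) (ev n) (K n) (averageOp (ρ n) T (K n))
        (Set.Icc (c + i * η - η) (c + i * η + η)) (Set.Icc (c + i * η - η) (c + i * η + η))
      ≤ N n * (64 * C₀ ^ 2 * T.card ^ 2 * (η * (η * F.card + δ / (4 * D)))) := by
    rw [eventually_all_finset]
    intro i hi
    have h := (hb _ (hcen i hi) η hη0 hη1).2
    exact eventually_windowSum_le hN hρ hp hφ hloc hK (by positivity) hF hC₀ hη0 hη1 h h
  filter_upwards [hwin, eventually_le_card_indexSet hN hρ hp hφ hC₀
    (hb ((c + d) / 2) ⟨by linarith, by linarith⟩) hη₀ hη₀1, hN.eventually_gt_atTop 0]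
    with n h1 h2 hn
  have hn' : (0 : ℝ) < N n := by exact_mod_cast hn
  have h3 : N n * (η₀ / (32 * C₀ ^ 3)) ≤ ((indexSet (ev n) (Set.Icc c d)).card : ℝ) := by
    refine h2.trans ?_
    gcongr
    intro α hα
    rw [mem_indexSet] at hα ⊢
    exact ⟨by linarith [hα.1], by linarith [hα.2]⟩
  have h4 : 0 < N n * (η₀ / (32 * C₀ ^ 3)) := by positivity
  rw [diagonalMoment, ← div_eq_inv_mul, div_lt_iff₀ (h4.trans_le h3)]
  refine (sum_diagonal_le_sum_windowSum _ _ _ _ _ _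
    (Icc_subset_iUnion_windows hη0 hkη)).trans_lt ?_
  have h5 := Finset.sum_le_card_nsmul _ _ _ h1
  rw [nsmul_eq_mul, Finset.card_range, Nat.cast_add, Nat.cast_one] at h5
  refine h5.trans_lt (lt_of_lt_of_le ?_ (mul_le_mul_of_nonneg_left h3 hδ.le))
  have h6 : D * (η * F.card + δ / (4 * D)) < δ := by
    have : D * (η * F.card + δ / (4 * D)) = η * (D * F.card) + δ / 4 := by field_simp
    nlinarith [mul_pos hη0 hD0]
  -- The number of windows times `η` stays bounded, which absorbs the single factor `η` in each
  -- window sum.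
  have h7 : (k + 1) * η ≤ 2 * (d - c) := by
    have := mul_le_mul_of_nonneg_right hk1 hη0.le
    linarith
  calc (k + 1) * (N n * (64 * C₀ ^ 2 * T.card ^ 2 * (η * (η * F.card + δ / (4 * D)))))
      = (k + 1) * η * (64 * C₀ ^ 2 * T.card ^ 2 * (32 * C₀ ^ 3 / η₀)) *
        (η * F.card + δ / (4 * D)) * (N n * (η₀ / (32 * C₀ ^ 3))) := by field_simp
    _ ≤ 2 * (d - c) * (64 * C₀ ^ 2 * T.card ^ 2 * (32 * C₀ ^ 3 / η₀)) *
        (η * F.card + δ / (4 * D)) * (N n * (η₀ / (32 * C₀ ^ 3))) := by gcongr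
    _ ≤ D * (η * F.card + δ / (4 * D)) * (N n * (η₀ / (32 * C₀ ^ 3))) := by
        gcongr
        linarith
    _ < δ * (N n * (η₀ / (32 * C₀ ^ 3))) := by gcongr

theorem ResolventBound.mono {I J : Set ℝ} (h : ResolventBound p J) (hIJ : I ⊆ J) :
    ResolventBound p I :=
  let ⟨C₀, hC₀, hb⟩ := h
  ⟨C₀, hC₀, fun E hE => hb E (hIJ hE)⟩

end Conclusion

end SchreierMixing

end

theorem theoremt {Γ : Type*} [Group Γ]
    (S : Finset Γ) (hS : Subgroup.closure (S : Set Γ) = ⊤)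
    (N : ℕ → ℕ) (hN : Tendsto N atTop atTop)
    (ρ : (n : ℕ) → Γ →* Equiv.Perm (Fin (N n)))
    (hρ : SchreierMixing.ConvergesInDistribution ρ)
    (p : MonoidAlgebra ℂ Γ) (hp : SchreierMixing.IsSelfAdjointElement p)
    (a b : ℝ) (hAC : SchreierMixing.ResolventBound p (Set.Icc a b))
    (c d : ℝ) (hcd : c < d) (hI : Set.Icc c d ⊆ interior (Set.Icc a b))
    (φ : (n : ℕ) → OrthonormalBasis (Fin (N n)) ℂ (EuclideanSpace ℂ (Fin (N n))))
    (ev : (n : ℕ) → Fin (N n) → ℝ)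
    (hφ : ∀ n, SchreierMixing.IsEigenbasis (SchreierMixing.schreierOp (ρ n) p) (φ n) (ev n))
    (T : Finset Γ)
    (K : (n : ℕ) → Matrix (Fin (N n)) (Fin (N n)) ℂ)
    (hloc : ∀ n, SchreierMixing.IsLocal (ρ n) T (K n))
    (hK : ∀ n x y, ‖K n x y‖ ≤ 1)
    (hunc : SchreierMixing.IsAsympUncorrelatedLocal S T ρ K) :
    SchreierMixing.QuantumErgodicity T ρ φ ev K (Set.Icc c d) ∧
      SchreierMixing.SmallScaleQuantumMixing T ρ φ ev K (Set.Icc c d) := by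
  have hb := hAC.mono (hI.trans interior_subset)
  exact ⟨SchreierMixing.quantumErgodicity_of_resolventBound hS hN hρ hp hcd hb hφ hloc hK hunc,
    SchreierMixing.smallScaleQuantumMixing_of_resolventBound hS hN hρ hp hb hφ hloc hK hunc⟩
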